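/- Let $d>3$ be a squarefree integer with $d\not\equiv 7 \pmod 8$, let $K=\mathbb{Q}(\sqrt{-d})$ with a fixed square root $\sqrt{-d}$ of $-d$, let $\mathcal{O}_K$ be its ring of integers and $\mathrm{Pic}(\mathcal{O}_K)$ its ideal class group. Let $$\mathscr{H}_d=\{(a,b,c)\in\mathbb{Z}^3 : a^2+b^2+c^2=d\},\qquad \widetilde{\mathscr{H}}_d=\mathrm{SO}_3(\mathbb{Z})\backslash\mathscr{H}_d,$$ and let $\widetilde{\mathscr{H}}_d^*=\widetilde{\mathscr{H}}_d$ if $d\equiv 3\pmod 4$, and $\widetilde{\mathscr{H}}_d^*=\mathrm{SO}_3(\mathbb{Z})^+\backslash\mathscr{H}_d$ if $d\equiv 1,2\pmod 4$, where $\mathrm{SO}_3(\mathbb{Z})^+\subset \mathrm{SO}_3(\mathbb{Z})$ is the index-$2$ subgroup of matrices that permute the three coordinate lines by an even permutation. Let $B$ be the Hamilton quaternion algebra over $\mathbb{Q}$, and $B(\mathbb{Z})=\mathbb{Z}[i,j,k,\tfrac{1+i+j+k}{2}]$ the ring of Hurwitz quaternions; identify $(a,b,c)\in\mathscr{H}_d$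 with $ai+bj+ck\in B(\mathbb{Z})$. For $x\in\mathscr{H}_d$ let $\mathcal{O}_x=B(\mathbb{Z})\cap\mathbb{Q}[x]$, which is identified with $\mathcal{O}_K$ by $\sqrt{-d}\mapsto x$. For $x,y\in\mathscr{H}_d$ let $$\Lambda_{x\to y}=\{\lambda\in B(\mathbb{Z}) : x\lambda=\lambda y\},$$ a left $\mathcal{O}_x$-module and a right $\mathcal{O}_y$-module, locally free of rank one on either side (the two structures agree under $\mathcal{O}_x\cong\mathcal{O}_K\cong\mathcal{O}_y$), and let $[\Lambda_{x\to y}]$ be its class in $\mathrm{Pic}(\mathcal{O}_x)=\mathrm{Pic}(\mathcal{O}_K)$. Then the set $\widetilde{\mathscr{H}}_d^*$ has the structure of a torsor (nonempty principal homogeneous space) for $\mathrm{Pic}(\mathcal{O}_K)$ in which, for all $x,y\in\mathscr{H}_d$, the unique element of $\mathrm{Pic}(\mathcal{O}_K)$ sending the orbit of $x$ to the orbit of $y$ is $[\Lambda_{x\to y}]$. This action descends along the projection $\widetilde{\mathscr{H}}_d^*\to\widetilde{\mathscr{H}}_d$ to a transitive action on $\widetilde{\mathscr{H}}_d$. The stabilizer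 of any point of $\widetilde{\mathscr{H}}_d$ is trivial if $d\equiv 3\pmod 4$, and is a subgroup of order $2$ generated by the class of a prime of $\mathcal{O}_K$ above $2$ if $d\equiv 1,2\pmod 4$. More precisely, for all $x,y,z\in\mathscr{H}_d$: (A) $\Lambda_{x\to y}\otimes_{\mathcal{O}_y}\Lambda_{y\to z}$ is isomorphic to $\Lambda_{x\to z}$ as an $(\mathcal{O}_x,\mathcal{O}_z)$-bimodule; (B) $[\Lambda_{x\to y}]$ is trivial if and only if $x$ and $y$ have the same image in $\widetilde{\mathscr{H}}_d^*$; (C) for every $x\in\mathscr{H}_d$ and every $g\in\mathrm{Pic}(\mathcal{O}_K)$ there is $y\in\mathscr{H}_d$ with $[\Lambda_{x\to y}]=g$; (D) if $d\equiv 1,2\pmod 4$ and $x,y$ have different images in $\widetilde{\mathscr{H}}_d^*$ but the same image in $\widetilde{\mathscr{H}}_d$, then $[\Lambda_{x\to y}]$ is the ideal class of a prime of $\mathcal{O}_K$ above $2$. In particular, $|\mathscr{H}_d|=24\,|\mathrm{Pic}(\mathcal{O}_K)|$ if $d\equiv 3\pmod 8$, and $|\mathscr{H}_d|=12\,|\mathrm{Pic}(\mathcal{O}_K)|$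 if $d\equiv 1,2\pmod 4$. -/

import Mathlib

open scoped Quaternion NumberField TensorProduct nonZeroDivisors

namespace ThreeSquares

/-! ### The set of representations and its quotients -/

/-- The integer points on the sphere of radius `√d`. -/
def sphere (d : ℕ) : Set (Fin 3 → ℤ) :=
  {v | v 0 ^ 2 + v 1 ^ 2 + v 2 ^ 2 = (d : ℤ)}

/-- The group `SO₃(ℤ)`. -/
abbrev SO3Z : Type := Matrix.specialOrthogonalGroup (Fin 3) ℤ

theorem SO3Z.transpose_mul (g : SO3Z) : (g : Matrix (Fin 3) (Fin 3) ℤ).transpose * g = 1 :=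
  (Matrix.mem_orthogonalGroup_iff' (Fin 3) ℤ).1 (Matrix.mem_specialOrthogonalGroup_iff.1 g.2).1

theorem SO3Z.inv_apply (g : SO3Z) (i j : Fin 3) :
    (g⁻¹ : SO3Z).1 i j = g.1 j i := rfl

theorem mulVec_mem_sphere {d : ℕ} (g : SO3Z) {v : Fin 3 → ℤ} (hv : v ∈ sphere d) :
    g.1.mulVec v ∈ sphere d := by
  have key : ∀ w : Fin 3 → ℤ, w ∈ sphere d ↔ w ⬝ᵥ w = (d : ℤ) := by
    intro w
    simp only [sphere, Set.mem_ofPred_eq, dotProduct, Fin.sum_univ_three, pow_two]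
  rw [key] at hv ⊢
  rw [Matrix.dotProduct_mulVec, Matrix.vecMul_mulVec, SO3Z.transpose_mul, Matrix.vecMul_one,
    hv]

/-- `SO₃(ℤ)` acts on the integer points of the sphere by multiplication of column vectors. -/
instance (d : ℕ) : MulAction SO3Z (sphere d) where
  smul g x := ⟨g.1.mulVec x.1, mulVec_mem_sphere g x.2⟩
  one_smul x := Subtype.ext (Matrix.one_mulVec x.1)
  mul_smul g h x := Subtype.ext (Matrix.mulVec_mulVec x.1 g.1 h.1).symm

/-- The subgroup `SO₃(ℤ)⁺` of those `g` which permute the three coordinate lines by an even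
permutation `σ`: the image of the `i`-th basis vector lies on the line of the `σ i`-th one. -/
def SO3ZPlus : Subgroup SO3Z where
  carrier := {g | ∃ σ : Equiv.Perm (Fin 3), Equiv.Perm.sign σ = 1 ∧
    ∀ i j, g.1 j i ≠ 0 → j = σ i}
  one_mem' := ⟨1, by simp, fun i j h => by
    by_contra hne
    exact h (Matrix.one_apply_ne hne)⟩
  mul_mem' := by
    rintro g h ⟨σ, hσ, hg⟩ ⟨τ, hτ, hh⟩
    refine ⟨σ * τ, by rw [map_mul, hσ, hτ, one_mul], fun i j hij => ?_⟩
    have hij' : ∑ k, g.1 j k * h.1 k i ≠ 0 := hij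
    obtain ⟨k, -, hk⟩ := Finset.exists_ne_zero_of_sum_ne_zero hij'
    have h1 := hg k j (left_ne_zero_of_mul hk)
    have h2 := hh i k (right_ne_zero_of_mul hk)
    rw [h1, h2, Equiv.Perm.mul_apply]
  inv_mem' := by
    rintro g ⟨σ, hσ, hg⟩
    refine ⟨σ⁻¹, by rw [map_inv, hσ, inv_one], fun i j hij => ?_⟩
    have h1 := hg j i (by rwa [SO3Z.inv_apply] at hij)
    rw [h1]; simp

/-- The quotient `SO₃(ℤ) \ H_d`. -/
abbrev HTilde (d : ℕ) : Type := MulAction.orbitRel.Quotient SO3Z (sphere d)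

/-- The group by which one divides: `SO₃(ℤ)` if `d ≡ 3 (mod 4)` and `SO₃(ℤ)⁺` otherwise. -/
def starGroup (d : ℕ) : Subgroup SO3Z := if d % 4 = 3 then ⊤ else SO3ZPlus

/-- The quotient of `H_d` by `SO₃(ℤ)` if `d ≡ 3 (mod 4)`, and by `SO₃(ℤ)⁺` otherwise. -/
abbrev HStar (d : ℕ) : Type := MulAction.orbitRel.Quotient (starGroup d) (sphere d)

/-- The orbit of `x` in `HStar d`. -/
def orbitStar {d : ℕ} (x : sphere d) : HStar d := Quotient.mk _ x

/-- The orbit of `x` in `HTilde d`. -/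
def orbit {d : ℕ} (x : sphere d) : HTilde d := Quotient.mk _ x

/-- The natural projection from `HStar d` onto `HTilde d`. -/
def proj {d : ℕ} : HStar d → HTilde d :=
  Quotient.map id fun _ _ h => by
    obtain ⟨g, hg⟩ := h
    exact ⟨g.1, hg⟩

/-! ### Quaternions -/

/-- The ring of Hurwitz quaternions `ℤ[i, j, k, (1 + i + j + k)/2]`. -/
def hurwitz : Subring ℍ[ℚ] :=
  Subring.closure {⟨0, 1, 0, 0⟩, ⟨0, 0, 1, 0⟩, ⟨0, 0, 0, 1⟩, ⟨1 / 2, 1 / 2, 1 / 2, 1 / 2⟩}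

theorem mem_hurwitz_iff (q : ℍ[ℚ]) : q ∈ hurwitz ↔ ∃ m a b c : ℤ,
    q.re = m / 2 ∧ q.imI = m / 2 + a ∧ q.imJ = m / 2 + b ∧ q.imK = m / 2 + c := by
  constructor
  · intro hq
    induction hq using Subring.closure_induction with
    | mem x hx =>
      rcases hx with rfl | rfl | rfl | rfl
      · exact ⟨0, 1, 0, 0, by simp⟩
      · exact ⟨0, 0, 1, 0, by simp⟩
      · exact ⟨0, 0, 0, 1, by simp⟩
      · exact ⟨1, 0, 0, 0, by simp⟩
    | zero => exact ⟨0, 0, 0, 0, by simp⟩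
    | one => exact ⟨2, -1, -1, -1, by simp⟩
    | add x y _ _ hx hy =>
      obtain ⟨m, a, b, c, h1, h2, h3, h4⟩ := hx
      obtain ⟨m', a', b', c', h1', h2', h3', h4'⟩ := hy
      refine ⟨m + m', a + a', b + b', c + c', ?_, ?_, ?_, ?_⟩ <;>
        simp [h1, h2, h3, h4, h1', h2', h3', h4'] <;> ring
    | neg x _ hx =>
      obtain ⟨m, a, b, c, h1, h2, h3, h4⟩ := hx
      refine ⟨-m, -a, -b, -c, ?_, ?_, ?_, ?_⟩ <;> simp [h1, h2, h3, h4] <;> ring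
    | mul x y _ _ hx hy =>
      obtain ⟨m, a, b, c, h1, h2, h3, h4⟩ := hx
      obtain ⟨n, a', b', c', h1', h2', h3', h4'⟩ := hy
      refine ⟨-m * n - m * (a' + b' + c') - n * (a + b + c) - 2 * (a * a' + b * b' + c * c'),
        m * n + m * a' + n * a + m * c' + n * b + (a * a' + b * b' + c * c') + (b * c' - c * b'),
        m * n + m * b' + n * b + m * a' + n * c + (a * a' + b * b' + c * c') + (c * a' - a * c'),
        m * n + m * c' + n * c + m * b' + n * a + (a * a' + b * b' + c * c') + (a * b' - b * a'),
        ?_, ?_, ?_, ?_⟩ <;>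
        simp [h1, h2, h3, h4, h1', h2', h3', h4'] <;> ring
  · rintro ⟨m, a, b, c, h1, h2, h3, h4⟩
    obtain ⟨i, hi, i1, i2, i3, i4⟩ : ∃ i ∈ hurwitz, i.re = 0 ∧ i.imI = 1 ∧ i.imJ = 0 ∧ i.imK = 0 :=
      ⟨_, Subring.subset_closure (Or.inl rfl), rfl, rfl, rfl, rfl⟩
    obtain ⟨j, hj, j1, j2, j3, j4⟩ : ∃ j ∈ hurwitz, j.re = 0 ∧ j.imI = 0 ∧ j.imJ = 1 ∧ j.imK = 0 :=
      ⟨_, Subring.subset_closure (Or.inr (Or.inl rfl)), rfl, rfl, rfl, rfl⟩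
    obtain ⟨k, hk, k1, k2, k3, k4⟩ : ∃ k ∈ hurwitz, k.re = 0 ∧ k.imI = 0 ∧ k.imJ = 0 ∧ k.imK = 1 :=
      ⟨_, Subring.subset_closure (Or.inr (Or.inr (Or.inl rfl))), rfl, rfl, rfl, rfl⟩
    obtain ⟨r, hr, r1, r2, r3, r4⟩ : ∃ r ∈ hurwitz, r.re = 1 / 2 ∧ r.imI = 1 / 2 ∧
        r.imJ = 1 / 2 ∧ r.imK = 1 / 2 :=
      ⟨_, Subring.subset_closure (Or.inr (Or.inr (Or.inr rfl))), rfl, rfl, rfl, rfl⟩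
    have hq : q = m • r + a • i + b • j + c • k := by
      ext <;> simp [h1, h2, h3, h4, i1, i2, i3, i4, j1, j2, j3, j4, k1, k2, k3, k4, r1, r2, r3, r4,
        div_eq_mul_inv]
    rw [hq]
    exact add_mem (add_mem (add_mem (zsmul_mem hr m) (zsmul_mem hi a)) (zsmul_mem hj b))
      (zsmul_mem hk c)

/-- The trace-free quaternion attached to an integer vector. -/
def toQuat (v : Fin 3 → ℤ) : ℍ[ℚ] := ⟨0, v 0, v 1, v 2⟩

@[simp] theorem toQuat_re (v : Fin 3 → ℤ) : (toQuat v).re = 0 := rfl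
@[simp] theorem toQuat_imI (v : Fin 3 → ℤ) : (toQuat v).imI = v 0 := rfl
@[simp] theorem toQuat_imJ (v : Fin 3 → ℤ) : (toQuat v).imJ = v 1 := rfl
@[simp] theorem toQuat_imK (v : Fin 3 → ℤ) : (toQuat v).imK = v 2 := rfl

theorem toQuat_mem_hurwitz (v : Fin 3 → ℤ) : toQuat v ∈ hurwitz :=
  (mem_hurwitz_iff _).2 ⟨0, v 0, v 1, v 2, by simp⟩

theorem star_mem_hurwitz {q : ℍ[ℚ]} (hq : q ∈ hurwitz) : star q ∈ hurwitz := by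
  obtain ⟨m, a, b, c, h1, h2, h3, h4⟩ := (mem_hurwitz_iff _).1 hq
  refine (mem_hurwitz_iff _).2 ⟨m, -m - a, -m - b, -m - c, ?_, ?_, ?_, ?_⟩ <;>
    simp [h1, h2, h3, h4] <;> ring

theorem sphere_cast {d : ℕ} (x : sphere d) :
    (x.1 0 : ℚ) ^ 2 + (x.1 1 : ℚ) ^ 2 + (x.1 2 : ℚ) ^ 2 = d := by
  have := x.2
  simp only [sphere, Set.mem_ofPred_eq] at this
  exact_mod_cast this

theorem toQuat_mul_self {d : ℕ} (x : sphere d) :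
    toQuat x.1 * toQuat x.1 = (-(d : ℚ)) • 1 + (0 : ℚ) • toQuat x.1 := by
  have := sphere_cast x
  ext <;> simp <;> linarith

/-- The order `O_x`, the intersection of the Hurwitz quaternions with `ℚ[x]`. -/
def order {d : ℕ} (x : sphere d) : Subring ℍ[ℚ] :=
  hurwitz ⊓ (Algebra.adjoin ℚ {toQuat x.1}).toSubring

/-- The group `Λ_{x → y}` of Hurwitz quaternions `l` with `x l = l y`. -/
def transporter {d : ℕ} (x y : sphere d) : AddSubgroup ℍ[ℚ] where
  carrier := {l | l ∈ hurwitz ∧ toQuat x.1 * l = l * toQuat y.1}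
  zero_mem' := ⟨zero_mem _, by simp⟩
  add_mem' := fun ha hb => ⟨add_mem ha.1 hb.1, by rw [mul_add, add_mul, ha.2, hb.2]⟩
  neg_mem' := fun ha => ⟨neg_mem ha.1, by rw [mul_neg, neg_mul, ha.2]⟩

/-! ### The imaginary quadratic field -/

/-- The imaginary quadratic field `ℚ(√-d)`; its element `ω` is the chosen square root of `-d`. -/
abbrev ImagQuad (d : ℕ) : Type := QuadraticAlgebra ℚ (-(d : ℚ)) 0

instance (d : ℕ) [hd : Fact (Squarefree d)] : Fact (∀ r : ℚ, r ^ 2 ≠ -(d : ℚ) + 0 * r) := ⟨by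
  intro r hr
  have h0 : 0 < d := Nat.pos_of_ne_zero hd.out.ne_zero
  have h1 : (0 : ℚ) < d := by exact_mod_cast h0
  nlinarith [sq_nonneg r]⟩

instance (d : ℕ) [Fact (Squarefree d)] : NumberField (ImagQuad d) where
  to_charZero := inferInstance
  to_finiteDimensional := inferInstanceAs (Module.Finite ℚ (QuadraticAlgebra ℚ (-(d : ℚ)) 0))

/-- The embedding of `ℚ(√-d)` into the rational quaternions sending `√-d` to `x`. -/
def iota {d : ℕ} (x : sphere d) : ImagQuad d →ₐ[ℚ] ℍ[ℚ] :=
  QuadraticAlgebra.lift ⟨toQuat x.1, toQuat_mul_self x⟩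

theorem iota_apply {d : ℕ} (x : sphere d) (z : ImagQuad d) :
    iota x z = z.re • 1 + z.im • toQuat x.1 := rfl

theorem iota_re {d : ℕ} (x : sphere d) (z : ImagQuad d) : (iota x z).re = z.re := by
  simp [iota_apply]

theorem iota_imI {d : ℕ} (x : sphere d) (z : ImagQuad d) :
    (iota x z).imI = z.im * x.1 0 := by
  simp [iota_apply]

theorem iota_imJ {d : ℕ} (x : sphere d) (z : ImagQuad d) :
    (iota x z).imJ = z.im * x.1 1 := by
  simp [iota_apply]

theorem iota_imK {d : ℕ} (x : sphere d) (z : ImagQuad d) :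
    (iota x z).imK = z.im * x.1 2 := by
  simp [iota_apply]

theorem iota_mul_eq_mul_iota {d : ℕ} {x y : sphere d} {l : ℍ[ℚ]}
    (hl : toQuat x.1 * l = l * toQuat y.1) (z : ImagQuad d) : iota x z * l = l * iota y z := by
  rw [iota_apply, iota_apply, add_mul, mul_add, smul_mul_assoc, smul_mul_assoc, mul_smul_comm,
    mul_smul_comm, hl, one_mul, mul_one]

theorem parity_of_four_squares {m a b c n : ℤ} (h : m ^ 2 + a ^ 2 + b ^ 2 + c ^ 2 = 4 * n) :
    2 ∣ a - m ∧ 2 ∣ b - m ∧ 2 ∣ c - m := by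
  have sq : ∀ t : ℤ, (t % 2 = 0 ∧ t ^ 2 % 4 = 0) ∨ (t % 2 = 1 ∧ t ^ 2 % 4 = 1) := by
    intro t
    rcases Int.emod_two_eq_zero_or_one t with ht | ht
    · refine Or.inl ⟨ht, ?_⟩
      obtain ⟨u, rfl⟩ := Int.dvd_of_emod_eq_zero ht
      rw [show (2 * u) ^ 2 = 4 * u ^ 2 by ring]
      omega
    · refine Or.inr ⟨ht, ?_⟩
      obtain ⟨u, rfl⟩ : ∃ u, t = 2 * u + 1 := ⟨t / 2, by omega⟩
      rw [show (2 * u + 1) ^ 2 = 4 * (u ^ 2 + u) + 1 by ring]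
      omega
  have h1 := sq m
  have h2 := sq a
  have h3 := sq b
  have h4 := sq c
  omega

theorem int_of_squarefree_mul_sq {d : ℕ} (hd : Squarefree d) {r : ℚ} {n : ℤ}
    (h : (d : ℚ) * r ^ 2 = n) : ∃ l : ℤ, r = l := by
  have hden : (r.den : ℚ) ≠ 0 := by exact_mod_cast r.den_nz
  have h1 : (d : ℤ) * r.num ^ 2 = n * (r.den : ℤ) ^ 2 := by
    have h2 : (d : ℚ) * (r.num : ℚ) ^ 2 = n * (r.den : ℚ) ^ 2 := by
      rw [← h, mul_assoc, ← mul_pow, Rat.mul_den_eq_num]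
    exact_mod_cast h2
  have hco : IsCoprime ((r.den : ℤ) ^ 2) (r.num ^ 2) := by
    apply IsCoprime.pow
    rw [Int.isCoprime_iff_gcd_eq_one, Int.gcd_comm]
    exact r.reduced
  have hdvd : (r.den : ℤ) ^ 2 ∣ d := hco.dvd_of_dvd_mul_right ⟨n, by rw [h1, mul_comm]⟩
  have hdvd' : r.den * r.den ∣ d := by
    rw [← pow_two]
    exact_mod_cast hdvd
  have hu : r.den = 1 := Nat.isUnit_iff.1 (hd _ hdvd')
  exact ⟨r.num, (Rat.den_eq_one_iff r |>.1 hu).symm⟩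

theorem exists_int_of_isIntegral {d : ℕ} [hd : Fact (Squarefree d)] {z : ImagQuad d}
    (hz : IsIntegral ℤ z) :
    ∃ m l n : ℤ, z.re = m / 2 ∧ z.im = l / 2 ∧ m ^ 2 + d * l ^ 2 = 4 * n := by
  let conj : ImagQuad d →ₐ[ℚ] ImagQuad d := QuadraticAlgebra.lift
    ⟨-QuadraticAlgebra.omega, by ext <;> simp⟩
  have hzc : IsIntegral ℤ (conj z) := hz.map (conj.restrictScalars ℤ)
  have hc : conj z = ⟨z.re, -z.im⟩ := by
    change z.re • (1 : ImagQuad d) + z.im • (-QuadraticAlgebra.omega) = _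
    ext <;> simp
  have key : ∀ r : ℚ, IsIntegral ℤ (⟨r, 0⟩ : ImagQuad d) → ∃ k : ℤ, r = k := by
    intro r hr
    have hr' : IsIntegral ℤ (algebraMap ℚ (ImagQuad d) r) := hr
    have := (isIntegral_algebraMap_iff (algebraMap ℚ (ImagQuad d)).injective).1 hr'
    obtain ⟨k, hk⟩ := IsIntegrallyClosed.isIntegral_iff.1 this
    exact ⟨k, hk.symm⟩
  obtain ⟨m, hm⟩ := key (2 * z.re) (by
    have e : (⟨2 * z.re, 0⟩ : ImagQuad d) = z + conj z := by
      rw [hc]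
      ext <;> simp
      ring
    rw [e]
    exact hz.add hzc)
  obtain ⟨n, hn⟩ := key (z.re ^ 2 + d * z.im ^ 2) (by
    have e : (⟨z.re ^ 2 + d * z.im ^ 2, 0⟩ : ImagQuad d) = z * conj z := by
      rw [hc]
      ext <;> simp <;> ring
    rw [e]
    exact hz.mul hzc)
  obtain ⟨l, hl⟩ := int_of_squarefree_mul_sq hd.out (r := 2 * z.im) (n := 4 * n - m ^ 2) (by
    push_cast
    rw [← hn, ← hm]
    ring)
  refine ⟨m, l, n, by linarith, by linarith, ?_⟩
  have : (m : ℚ) ^ 2 + d * (l : ℚ) ^ 2 = 4 * n := by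
    rw [← hm, ← hl, ← hn]
    ring
  exact_mod_cast this

/-- The embedding `ι_x` identifies the ring of integers of `ℚ(√-d)` with `O_x`. -/
theorem iota_mem_hurwitz_iff {d : ℕ} [Fact (Squarefree d)] (x : sphere d) (z : ImagQuad d) :
    iota x z ∈ hurwitz ↔ IsIntegral ℤ z := by
  have hx := sphere_cast x
  constructor
  · intro h
    obtain ⟨m, a, b, c, h1, h2, h3, h4⟩ := (mem_hurwitz_iff _).1 h
    rw [iota_re] at h1
    rw [iota_imI] at h2
    rw [iota_imJ] at h3
    rw [iota_imK] at h4
    let n : ℤ := m ^ 2 + m * (a + b + c) + a ^ 2 + b ^ 2 + c ^ 2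
    have hn : z.re ^ 2 + d * z.im ^ 2 = n := by
      have : z.re ^ 2 + ((x.1 0 : ℚ) ^ 2 + (x.1 1 : ℚ) ^ 2 + (x.1 2 : ℚ) ^ 2) * z.im ^ 2 =
        z.re ^ 2 + (z.im * x.1 0) ^ 2 + (z.im * x.1 1) ^ 2 + (z.im * x.1 2) ^ 2 := by ring
      rw [hx, h1, h2, h3, h4] at this
      rw [h1, this]
      push_cast [n]
      ring
    refine ⟨Polynomial.X ^ 2 + (Polynomial.C (-m) * Polynomial.X + Polynomial.C n), ?_, ?_⟩
    · exact Polynomial.monic_X_pow_add (by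
        exact lt_of_le_of_lt Polynomial.degree_linear_le (by norm_num))
    · have hn' : (n : ImagQuad d) = ⟨z.re ^ 2 + d * z.im ^ 2, 0⟩ := by
        rw [hn]; ext <;> simp
      have hm' : (m : ImagQuad d) = ⟨2 * z.re, 0⟩ := by
        have h1' : 2 * z.re = m := by linarith
        rw [h1']; ext <;> simp
      simp only [Polynomial.eval₂_add, Polynomial.eval₂_mul, Polynomial.eval₂_pow,
        Polynomial.eval₂_X, Polynomial.eval₂_C]
      simp only [eq_intCast, Int.cast_neg, hn', hm', pow_two]
      ext <;> simp <;> ring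
  · intro h
    obtain ⟨m, l, n, hm, hl, hmn⟩ := exists_int_of_isIntegral h
    have hx' := x.2
    simp only [sphere, Set.mem_ofPred_eq] at hx'
    obtain ⟨⟨a, ha⟩, ⟨b, hb⟩, ⟨c, hc⟩⟩ := parity_of_four_squares (m := m) (a := l * x.1 0)
      (b := l * x.1 1) (c := l * x.1 2) (n := n) (by rw [← hmn, ← hx']; ring)
    have ha' : (l : ℚ) * x.1 0 - m = 2 * a := by exact_mod_cast ha
    have hb' : (l : ℚ) * x.1 1 - m = 2 * b := by exact_mod_cast hb
    have hc' : (l : ℚ) * x.1 2 - m = 2 * c := by exact_mod_cast hc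
    refine (mem_hurwitz_iff _).2 ⟨m, a, b, c, ?_, ?_, ?_, ?_⟩
    · rw [iota_re, hm]
    · rw [iota_imI, hl]; linarith
    · rw [iota_imJ, hl]; linarith
    · rw [iota_imK, hl]; linarith

/-- The ring of integers acts on `Λ_{x → y}` through `ι_x` and left multiplication. -/
noncomputable instance {d : ℕ} [Fact (Squarefree d)] (x y : sphere d) :
    Module (𝓞 (ImagQuad d)) (transporter x y) where
  smul a l := ⟨iota x a * l.1, mul_mem ((iota_mem_hurwitz_iff x a).2 a.isIntegral_coe) l.2.1, by
    rw [← mul_assoc, mul_assoc _ l.1, ← l.2.2, ← mul_assoc, iota_mul_eq_mul_iota rfl]⟩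
  one_smul l := Subtype.ext (by
    change iota x ((1 : 𝓞 (ImagQuad d)) : ImagQuad d) * l.1 = l.1
    simp)
  mul_smul a b l := Subtype.ext (by
    change iota x ((a * b : 𝓞 (ImagQuad d)) : ImagQuad d) * l.1 = iota x a * (iota x b * l.1)
    simp [mul_assoc])
  smul_zero a := Subtype.ext (mul_zero _)
  smul_add a l l' := Subtype.ext (mul_add _ _ _)
  add_smul a b l := Subtype.ext (by
    change iota x ((a + b : 𝓞 (ImagQuad d)) : ImagQuad d) * l.1 = iota x a * l.1 + iota x b * l.1
    simp [add_mul])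
  zero_smul l := Subtype.ext (by
    change iota x ((0 : 𝓞 (ImagQuad d)) : ImagQuad d) * l.1 = 0
    simp)

theorem coe_smul_eq {d : ℕ} [Fact (Squarefree d)] {x y : sphere d} (a : 𝓞 (ImagQuad d))
    (l : transporter x y) : (a • l).1 = iota x a * l.1 := rfl

/-- The same action is right multiplication through `ι_y`. -/
theorem coe_smul_eq' {d : ℕ} [Fact (Squarefree d)] {x y : sphere d} (a : 𝓞 (ImagQuad d))
    (l : transporter x y) : (a • l).1 = l.1 * iota y a :=
  iota_mul_eq_mul_iota l.2.2 a

/-- The order `O_x` is the image of the ring of integers under `ι_x`. -/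
theorem mem_order_iff {d : ℕ} [Fact (Squarefree d)] (x : sphere d) (q : ℍ[ℚ]) :
    q ∈ order x ↔ ∃ a : 𝓞 (ImagQuad d), iota x a = q := by
  have hrange : Algebra.adjoin ℚ {toQuat x.1} = (iota x).range := by
    apply le_antisymm
    · rw [Algebra.adjoin_le_iff, Set.singleton_subset_iff]
      exact ⟨QuadraticAlgebra.omega, by simp [iota]⟩
    · rintro _ ⟨z, rfl⟩
      have h1 := Subalgebra.smul_mem (Algebra.adjoin ℚ {toQuat x.1}) (one_mem _) z.re
      have h2 := Subalgebra.smul_mem (Algebra.adjoin ℚ {toQuat x.1})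
        (Algebra.subset_adjoin (Set.mem_singleton (toQuat x.1))) z.im
      exact add_mem h1 h2
  constructor
  · rintro ⟨h1, h2⟩
    have h3 : q ∈ Algebra.adjoin ℚ {toQuat x.1} := h2
    rw [hrange] at h3
    obtain ⟨z, rfl⟩ := h3
    exact ⟨⟨z, (iota_mem_hurwitz_iff x z).1 h1⟩, rfl⟩
  · rintro ⟨a, rfl⟩
    refine ⟨(iota_mem_hurwitz_iff x a).2 a.isIntegral_coe, ?_⟩
    change iota x a ∈ Algebra.adjoin ℚ {toQuat x.1}
    rw [hrange]
    exact ⟨_, rfl⟩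

theorem sphere_pos {d : ℕ} [hd : Fact (Squarefree d)] : (0 : ℚ) < d := by
  exact_mod_cast Nat.pos_of_ne_zero hd.out.ne_zero

theorem exists_iota_of_commute {d : ℕ} [Fact (Squarefree d)] (x : sphere d) {q : ℍ[ℚ]}
    (h : toQuat x.1 * q = q * toQuat x.1) : ∃ z, iota x z = q := by
  have hx := sphere_cast x
  have hd := sphere_pos (d := d)
  have h1 := congrArg QuaternionAlgebra.imI h
  have h2 := congrArg QuaternionAlgebra.imJ h
  have h3 := congrArg QuaternionAlgebra.imK h
  simp at h1 h2 h3
  let t : ℚ := (q.imI * x.1 0 + q.imJ * x.1 1 + q.imK * x.1 2) / d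
  have ht : t * d = q.imI * x.1 0 + q.imJ * x.1 1 + q.imK * x.1 2 :=
    div_mul_cancel₀ _ hd.ne'
  refine ⟨⟨q.re, t⟩, ?_⟩
  ext
  · simp [iota_re]
  · rw [iota_imI]
    apply mul_right_cancel₀ hd.ne'
    linear_combination (x.1 0 : ℚ) * ht + q.imI * hx - (x.1 2 : ℚ) / 2 * h2 + (x.1 1 : ℚ) / 2 * h3
  · rw [iota_imJ]
    apply mul_right_cancel₀ hd.ne'
    linear_combination (x.1 1 : ℚ) * ht + q.imJ * hx - (x.1 0 : ℚ) / 2 * h3 + (x.1 2 : ℚ) / 2 * h1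
  · rw [iota_imK]
    apply mul_right_cancel₀ hd.ne'
    linear_combination (x.1 2 : ℚ) * ht + q.imK * hx - (x.1 1 : ℚ) / 2 * h1 + (x.1 0 : ℚ) / 2 * h2

theorem exists_ne_zero_mem_transporter {d : ℕ} [Fact (Squarefree d)] (x y : sphere d) :
    ∃ l ∈ transporter x y, l ≠ 0 := by
  have hd := sphere_pos (d := d)
  have hx := sphere_cast x
  have mem : ∀ v ∈ hurwitz, toQuat x.1 * v + v * toQuat y.1 ∈ transporter x y := by
    intro v hv
    refine ⟨add_mem (mul_mem (toQuat_mem_hurwitz _) hv) (mul_mem hv (toQuat_mem_hurwitz _)), ?_⟩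
    rw [mul_add, add_mul, ← mul_assoc, toQuat_mul_self, mul_assoc v, toQuat_mul_self, ← mul_assoc]
    simp [add_comm, (Nat.cast_commute d v).eq]
  by_contra! hzero
  have h1 := hzero _ (mem 1 (one_mem _))
  have h2 := hzero _ (mem (toQuat ![1, 0, 0]) (toQuat_mem_hurwitz _))
  have h3 := hzero _ (mem (toQuat ![0, 1, 0]) (toQuat_mem_hurwitz _))
  have hy : toQuat y.1 = - toQuat x.1 := by
    rw [mul_one, one_mul] at h1
    exact (neg_eq_of_add_eq_zero_right h1).symm
  rw [hy] at h2 h3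
  have e2 := congrArg QuaternionAlgebra.imJ h2
  have e3 := congrArg QuaternionAlgebra.imK h2
  have e1 := congrArg QuaternionAlgebra.imK h3
  simp at e1 e2 e3
  rw [e1, e2, e3] at hx
  simp at hx
  linarith

theorem invertible_of_ne_bot {R : Type*} [CommRing R] [IsDedekindDomain R] {I : Ideal R}
    (hI : I ≠ ⊥) : Module.Invertible R I := by
  have hI' : (I : FractionalIdeal R⁰ (FractionRing R)) ≠ 0 := FractionalIdeal.coeIdeal_ne_zero.2 hI
  have h : ∀ J : (Submodule R (FractionRing R))ˣ,
      (J : Submodule R (FractionRing R)) = IsLocalization.coeSubmodule (FractionRing R) I →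
      Module.Invertible R (IsLocalization.coeSubmodule (FractionRing R) I) := by
    intro J hJ
    rw [← hJ]
    infer_instance
  have h' : Module.Invertible R (Submodule.map (Algebra.linearMap R (FractionRing R)) I) :=
    h (Units.map (FractionalIdeal.coeSubmoduleHom R⁰ (FractionRing R)).toMonoidHom
    (Units.mk0 _ hI')) rfl
  exact Module.Invertible.congr (Submodule.equivMapOfInjective
    (Algebra.linearMap R (FractionRing R)) (IsFractionRing.injective R (FractionRing R)) I).symm

/-- `Λ_{x → y}` is locally free of rank one. -/
instance {d : ℕ} [Fact (Squarefree d)] (x y : sphere d) :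
    Module.Invertible (𝓞 (ImagQuad d)) (transporter x y) := by
  obtain ⟨l₀, h₀, hne⟩ := exists_ne_zero_mem_transporter x y
  have hinj : Function.Injective (iota x) := (iota x).toRingHom.injective
  have hstar : ∀ v : Fin 3 → ℤ, star (toQuat v) = - toQuat v := by
    intro v
    ext <;> simp
  have hcomm : toQuat y.1 * star l₀ = star l₀ * toQuat x.1 := by
    have := congrArg star h₀.2
    rw [star_mul, star_mul, hstar, hstar, mul_neg, neg_mul, neg_inj] at this
    exact this.symm
  have hex : ∀ l : transporter x y, ∃ a : 𝓞 (ImagQuad d), iota x a = l.1 * star l₀ := by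
    intro l
    obtain ⟨z, hz⟩ := exists_iota_of_commute x (q := l.1 * star l₀) (by
      rw [← mul_assoc, l.2.2, mul_assoc, hcomm, mul_assoc])
    have hmem : iota x z ∈ hurwitz := by
      rw [hz]
      exact mul_mem l.2.1 (star_mem_hurwitz h₀.1)
    exact ⟨⟨z, (iota_mem_hurwitz_iff x z).1 hmem⟩, hz⟩
  choose f hf using hex
  have hs : star l₀ ≠ 0 := star_ne_zero.2 hne
  let F : transporter x y →ₗ[𝓞 (ImagQuad d)] 𝓞 (ImagQuad d) :=
    { toFun := f
      map_add' := fun l l' => by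
        apply NumberField.RingOfIntegers.ext
        apply hinj
        change iota x (f (l + l') : ImagQuad d) = iota x ((f l : ImagQuad d) + f l')
        rw [map_add, hf, hf, hf]
        exact add_mul _ _ _
      map_smul' := fun a l => by
        apply NumberField.RingOfIntegers.ext
        apply hinj
        change iota x (f (a • l) : ImagQuad d) = iota x ((a : ImagQuad d) * f l)
        rw [map_mul, hf, hf, coe_smul_eq, mul_assoc] }
  have hF : Function.Injective F := by
    intro l l' h
    have h' : f l = f l' := h
    have := hf l
    rw [h', hf l'] at this
    exact Subtype.ext (mul_right_cancel₀ hs this).symm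
  have hne' : (LinearMap.range F : Ideal (𝓞 (ImagQuad d))) ≠ ⊥ := by
    intro hbot
    have h0 : F ⟨l₀, h₀⟩ = F 0 := by
      rw [LinearMap.range_eq_bot.1 hbot]
      rfl
    exact hne (congrArg Subtype.val (hF h0))
  have := invertible_of_ne_bot hne'
  exact Module.Invertible.congr (LinearEquiv.ofInjective F hF).symm

/-- The class `[Λ_{x → y}]` in the ideal class group of the ring of integers of `ℚ(√-d)`. -/
noncomputable def latticeClass {d : ℕ} [Fact (Squarefree d)] (x y : sphere d) :
    ClassGroup (𝓞 (ImagQuad d)) :=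
  (ClassGroup.equivPic (𝓞 (ImagQuad d))).symm
    (CommRing.Pic.mk (𝓞 (ImagQuad d)) (transporter x y))

/-- The nonzero ideal `p` is a prime above `2`. -/
def IsPrimeAboveTwo {d : ℕ} [Fact (Squarefree d)] (p : (Ideal (𝓞 (ImagQuad d)))⁰) : Prop :=
  p.1.IsPrime ∧ (2 : 𝓞 (ImagQuad d)) ∈ p.1

end ThreeSquares

open ThreeSquares

namespace ThreeSquares

/-! ### Invertible ideals and the Picard group -/

/-! Everything is read off from the norms of the elements of `Λ_{x→y}`. Write `B` for the Hurwitz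
order. Two facts about it are used. It is norm-Euclidean, so right ideals are principal
(`exists_generator`). It is ramified at 2, so an element whose norm is divisible by 4 is twice a
Hurwitz element (`half_smul_mem_hurwitz`).

The central estimate is `dvd_two_of_dvd_nrm`: an integer dividing all norms on `Λ_{x→y}` divides 2.
At an odd prime the elements `x v + v y` already suffice, because `d` is squarefree; at 2, norms all
divisible by 4 would allow division by 2 for ever. If `d ≡ 1, 2 (mod 4)`, then `O_x` contains an
element of norm `2 (mod 4)`, and odd norms exist.

Composition (A): the image of multiplication contains `l (l̄ t) = N(l) t`, so it contains `2 t` for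
every `t`, and `t` itself once an odd norm occurs. If there is no odd norm on either factor, all
products are divisible by 2, and halved multiplication is onto. A surjection of invertible modules
of rank one is an isomorphism.

Trivial classes (B): if `Λ_{x→y} = O_x g`, then `N(g)` divides every norm, so `N(g)` is 1 or 2, and
it is 1 if `d ≡ 1, 2 (mod 4)`. Conjugations by elements of norm 1 are the rotations in `SO₃(ℤ)⁺`,
those by elements of norm 2 the remaining ones. Conversely an element of norm 1 generates, and so
does one of norm 2 if `d ≡ 3 (mod 8)`, where 2 is inert. In general an element of norm 2 identifies
the lattice with the prime `{a : 2 ∣ N(a)}`, which gives (D) and the stabilisers.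

Every class (C): for an ideal `I` of `O_x` write `I B = g B` and `y = g⁻¹ x g`; then `Λ_{x→y} = I⁻¹
g`.

Non-emptiness is the three squares theorem. Dirichlet's theorem, reciprocity and a pigeonhole
argument give a rational point, and principality of right ideals makes it integral. The count
follows since rotations act freely when `d > 3`. -/

theorem equivPic_mk0 {R : Type*} [CommRing R] [IsDedekindDomain R] (I : (Ideal R)⁰)
    [Module.Invertible R I.1] :
    ClassGroup.equivPic R (ClassGroup.mk0 I) = CommRing.Pic.mk R I.1 := by
  let J : (Submodule R (FractionRing R))ˣ :=
    Units.map (FractionalIdeal.coeSubmoduleHom R⁰ (FractionRing R)).toMonoidHom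
      (FractionalIdeal.mk0 (FractionRing R) I)
  have h : ClassGroup.equivPic R (ClassGroup.mk0 I) = CommRing.Pic.mk R J := by
    rw [ClassGroup.mk0_eq_quotientMk]
    rfl
  rw [h, CommRing.Pic.mk_eq_mk_iff]
  exact ⟨(Submodule.equivMapOfInjective (Algebra.linearMap R (FractionRing R))
    (IsFractionRing.injective R (FractionRing R)) I.1).symm⟩

/-! ### Integral norms of Hurwitz quaternions -/

/-- The norm of a Hurwitz quaternion, as an integer. -/
def nrm (q : ℍ[ℚ]) : ℤ := (Quaternion.normSq q).num

theorem nrm_of_eq {q : ℍ[ℚ]} {n : ℤ} (h : Quaternion.normSq q = n) : nrm q = n := by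
  rw [nrm, h, Rat.num_intCast]

theorem cast_nrm {q : ℍ[ℚ]} (hq : q ∈ hurwitz) : (nrm q : ℚ) = Quaternion.normSq q := by
  obtain ⟨m, a, b, c, h1, h2, h3, h4⟩ := (mem_hurwitz_iff _).1 hq
  have h : Quaternion.normSq q =
      ((m ^ 2 + m * (a + b + c) + a ^ 2 + b ^ 2 + c ^ 2 : ℤ) : ℚ) := by
    rw [Quaternion.normSq_def', h1, h2, h3, h4]
    push_cast
    ring
  rw [nrm_of_eq h, h]

theorem nrm_mul {p q : ℍ[ℚ]} (hp : p ∈ hurwitz) (hq : q ∈ hurwitz) :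
    nrm (p * q) = nrm p * nrm q :=
  nrm_of_eq (by rw [map_mul, Int.cast_mul, cast_nrm hp, cast_nrm hq])

theorem nrm_star (q : ℍ[ℚ]) : nrm (star q) = nrm q := by
  rw [nrm, nrm, Quaternion.normSq_star]

theorem nrm_nonneg (q : ℍ[ℚ]) : 0 ≤ nrm q :=
  Rat.num_nonneg.2 Quaternion.normSq_nonneg

theorem nrm_eq_zero {q : ℍ[ℚ]} : nrm q = 0 ↔ q = 0 := by
  rw [nrm, Rat.num_eq_zero, Quaternion.normSq_eq_zero]

theorem nrm_one : nrm 1 = 1 := nrm_of_eq (by simp)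

theorem nrm_smul_int (n : ℤ) {q : ℍ[ℚ]} (hq : q ∈ hurwitz) : nrm ((n : ℚ) • q) = n ^ 2 * nrm q :=
  nrm_of_eq (by rw [Quaternion.normSq_smul, ← cast_nrm hq]; push_cast; ring)

theorem mul_star_eq_nrm {q : ℍ[ℚ]} (hq : q ∈ hurwitz) : q * star q = (nrm q : ℚ) • 1 := by
  rw [Quaternion.self_mul_star, cast_nrm hq, ← Algebra.algebraMap_eq_smul_one]
  rfl

theorem star_mul_eq_nrm {q : ℍ[ℚ]} (hq : q ∈ hurwitz) : star q * q = (nrm q : ℚ) • 1 := by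
  rw [Quaternion.star_mul_self, cast_nrm hq, ← Algebra.algebraMap_eq_smul_one]
  rfl

theorem intCast_smul_mem_hurwitz (n : ℤ) {q : ℍ[ℚ]} (hq : q ∈ hurwitz) :
    (n : ℚ) • q ∈ hurwitz := by
  rw [Int.cast_smul_eq_zsmul]
  exact zsmul_mem hq n

/-- A quaternion with halved integer coordinates `t / 2` of even square sum `4 n` is Hurwitz. -/
theorem mem_hurwitz_of_four_squares {q : ℍ[ℚ]} {t u v w n : ℤ} (h0 : q.re = t / 2)
    (h1 : q.imI = u / 2) (h2 : q.imJ = v / 2) (h3 : q.imK = w / 2)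
    (h : t ^ 2 + u ^ 2 + v ^ 2 + w ^ 2 = 4 * n) : q ∈ hurwitz := by
  obtain ⟨⟨a, ha⟩, ⟨b, hb⟩, ⟨c, hc⟩⟩ := parity_of_four_squares h
  refine (mem_hurwitz_iff _).2 ⟨t, a, b, c, h0, ?_, ?_, ?_⟩
  · rw [h1, show u = t + 2 * a by omega]; push_cast; ring
  · rw [h2, show v = t + 2 * b by omega]; push_cast; ring
  · rw [h3, show w = t + 2 * c by omega]; push_cast; ring

/-- Twice the coordinates of a Hurwitz quaternion. -/
theorem exists_doubled {q : ℍ[ℚ]} (hq : q ∈ hurwitz) : ∃ t u v w : ℤ,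
    q.re = t / 2 ∧ q.imI = u / 2 ∧ q.imJ = v / 2 ∧ q.imK = w / 2 ∧
    2 ∣ u - t ∧ 2 ∣ v - t ∧ 2 ∣ w - t ∧ t ^ 2 + u ^ 2 + v ^ 2 + w ^ 2 = 4 * nrm q := by
  have hn := cast_nrm hq
  obtain ⟨m, a, b, c, h1, h2, h3, h4⟩ := (mem_hurwitz_iff _).1 hq
  refine ⟨m, m + 2 * a, m + 2 * b, m + 2 * c, h1, ?_, ?_, ?_, by omega, by omega, by omega, ?_⟩
  · rw [h2]; push_cast; ring
  · rw [h3]; push_cast; ring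
  · rw [h4]; push_cast; ring
  · rw [Quaternion.normSq_def', h1, h2, h3, h4] at hn
    have : ((m ^ 2 + (m + 2 * a) ^ 2 + (m + 2 * b) ^ 2 + (m + 2 * c) ^ 2 : ℤ) : ℚ) =
        ((4 * nrm q : ℤ) : ℚ) := by
      push_cast
      rw [hn]
      ring
    exact_mod_cast this

/-- At the ramified prime `2`, a Hurwitz quaternion is divisible by `2` once its norm is divisible
by `4`. -/
theorem half_smul_mem_hurwitz {q : ℍ[ℚ]} (hq : q ∈ hurwitz) (h4 : 4 ∣ nrm q) :
    (2⁻¹ : ℚ) • q ∈ hurwitz := by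
  obtain ⟨t, u, v, w, h0, h1, h2, h3, hu, hv, hw, hs⟩ := exists_doubled hq
  obtain ⟨k, hk⟩ := h4
  have odd_sq : ∀ s : ℤ, s % 2 = 1 → s ^ 2 % 8 = 1 := by
    intro s hs
    have : s % 8 = 1 ∨ s % 8 = 3 ∨ s % 8 = 5 ∨ s % 8 = 7 := by omega
    rcases this with h | h | h | h <;> simp [pow_two, Int.mul_emod, h]
  -- Four odd squares sum to `4 (mod 8)`, whereas the sum of squares is `4 * nrm q`, a multiple of
  -- 16.
  have ht : t % 2 = 0 := by
    by_contra hne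
    have e0 := odd_sq t (by omega)
    have e1 := odd_sq u (by omega)
    have e2 := odd_sq v (by omega)
    have e3 := odd_sq w (by omega)
    omega
  obtain ⟨t', rfl⟩ : 2 ∣ t := by omega
  obtain ⟨u', rfl⟩ : 2 ∣ u := by omega
  obtain ⟨v', rfl⟩ : 2 ∣ v := by omega
  obtain ⟨w', rfl⟩ : 2 ∣ w := by omega
  refine mem_hurwitz_of_four_squares (t := t') (u := u') (v := v') (w := w') (n := k) ?_ ?_ ?_ ?_
    (by linarith)
  · rw [Quaternion.re_smul, h0, smul_eq_mul]; push_cast; ring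
  · rw [Quaternion.imI_smul, h1, smul_eq_mul]; push_cast; ring
  · rw [Quaternion.imJ_smul, h2, smul_eq_mul]; push_cast; ring
  · rw [Quaternion.imK_smul, h3, smul_eq_mul]; push_cast; ring

/-! ### Right ideals of the Hurwitz order are principal -/

/-- Rounding each coordinate leaves an error of norm at most `4 · (1/4) = 1`. Equality forces every
coordinate to be half an odd integer, and such a point is itself Hurwitz. -/
theorem exists_hurwitz_near (t : ℍ[ℚ]) : ∃ q ∈ hurwitz, Quaternion.normSq (t - q) < 1 := by
  by_cases h : ∃ q ∈ hurwitz, t = q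
  · obtain ⟨q, hq, rfl⟩ := h
    exact ⟨t, hq, by simp⟩
  have bound : ∀ r : ℚ, (r - round r) ^ 2 ≤ 1 / 4 := by
    intro r
    have := abs_sub_round r
    rw [← sq_abs]
    nlinarith [abs_nonneg (r - round r)]
  let q : ℍ[ℚ] := ⟨round t.re, round t.imI, round t.imJ, round t.imK⟩
  have hq : q ∈ hurwitz := (mem_hurwitz_iff _).2 ⟨2 * round t.re, round t.imI - round t.re,
    round t.imJ - round t.re, round t.imK - round t.re, by simp [q]⟩
  have hn : Quaternion.normSq (t - q) = (t.re - round t.re) ^ 2 + (t.imI - round t.imI) ^ 2 +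
      (t.imJ - round t.imJ) ^ 2 + (t.imK - round t.imK) ^ 2 := Quaternion.normSq_def' _
  refine ⟨q, hq, lt_of_le_of_ne ?_ fun heq => h ?_⟩
  · linarith [bound t.re, bound t.imI, bound t.imJ, bound t.imK]
  · rw [hn] at heq
    have half : ∀ r : ℚ, (r - round r) ^ 2 = 1 / 4 → ∃ s : ℤ, r = s / 2 ∧ s % 2 = 1 := by
      intro r hr
      have : (r - round r - 1 / 2) * (r - round r + 1 / 2) = 0 := by linear_combination hr
      rcases mul_eq_zero.1 this with h | h
      · exact ⟨2 * round r + 1, by push_cast; linarith, by omega⟩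
      · exact ⟨2 * round r - 1, by push_cast; linarith, by omega⟩
    have b0 := bound t.re
    have b1 := bound t.imI
    have b2 := bound t.imJ
    have b3 := bound t.imK
    obtain ⟨m, hm, pm⟩ := half t.re (by linarith)
    obtain ⟨u, hu, pu⟩ := half t.imI (by linarith)
    obtain ⟨v, hv, pv⟩ := half t.imJ (by linarith)
    obtain ⟨w, hw, pw⟩ := half t.imK (by linarith)
    obtain ⟨a, ha⟩ : 2 ∣ u - m := by omega
    obtain ⟨b, hb⟩ : 2 ∣ v - m := by omega
    obtain ⟨c, hc⟩ : 2 ∣ w - m := by omega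
    refine ⟨t, (mem_hurwitz_iff _).2 ⟨m, a, b, c, hm, ?_, ?_, ?_⟩, rfl⟩
    · rw [hu, show u = m + 2 * a by omega]; push_cast; ring
    · rw [hv, show v = m + 2 * b by omega]; push_cast; ring
    · rw [hw, show w = m + 2 * c by omega]; push_cast; ring

/-- Euclidean division: an element `g` of least positive norm generates, since the remainder `m - g
q` has smaller norm when `q` is close to `g⁻¹ m`. -/
theorem exists_generator (M : AddSubgroup ℍ[ℚ]) (hM : ∀ m ∈ M, m ∈ hurwitz)
    (hmul : ∀ m ∈ M, ∀ q ∈ hurwitz, m * q ∈ M) (hne : ∃ m ∈ M, m ≠ 0) :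
    ∃ g ∈ M, g ≠ 0 ∧ ∀ m ∈ M, ∃ q ∈ hurwitz, m = g * q := by
  have hex : ∃ n : ℕ, ∃ m ∈ M, m ≠ 0 ∧ (nrm m).toNat = n := by
    obtain ⟨m, hm, h0⟩ := hne
    exact ⟨_, m, hm, h0, rfl⟩
  classical
  obtain ⟨g, hg, g0, hgn⟩ := Nat.find_spec hex
  refine ⟨g, hg, g0, fun m hm => ?_⟩
  obtain ⟨q, hq, hlt⟩ := exists_hurwitz_near (g⁻¹ * m)
  refine ⟨q, hq, ?_⟩
  have hmem : m - g * q ∈ M := sub_mem hm (hmul g hg q hq)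
  by_contra hne'
  have hmin := Nat.find_min' hex ⟨m - g * q, hmem, sub_ne_zero.2 hne', rfl⟩
  rw [← hgn] at hmin
  have hpos : 0 < Quaternion.normSq g :=
    lt_of_le_of_ne Quaternion.normSq_nonneg (Ne.symm (Quaternion.normSq_ne_zero.2 g0))
  have heq : m - g * q = g * (g⁻¹ * m - q) := by
    rw [mul_sub, ← mul_assoc, mul_inv_cancel₀ g0, one_mul]
  have h1 : Quaternion.normSq (m - g * q) < Quaternion.normSq g := by
    rw [heq, map_mul]
    nlinarith
  rw [← cast_nrm (hM _ hmem), ← cast_nrm (hM _ hg)] at h1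
  have h2 : nrm (m - g * q) < nrm g := by exact_mod_cast h1
  have := nrm_nonneg (m - g * q)
  omega

/-- A quaternion stabilising a nonzero right ideal of the Hurwitz order from the left is conjugate
to a Hurwitz quaternion by a generator of that ideal. -/
theorem exists_generator_conj (M : AddSubgroup ℍ[ℚ]) (hM : ∀ m ∈ M, m ∈ hurwitz)
    (hmul : ∀ m ∈ M, ∀ q ∈ hurwitz, m * q ∈ M) (hne : ∃ m ∈ M, m ≠ 0) {x : ℍ[ℚ]}
    (hx : ∀ m ∈ M, x * m ∈ M) :
    ∃ g ∈ M, g ≠ 0 ∧ (∀ m ∈ M, ∃ q ∈ hurwitz, m = g * q) ∧ ∃ y ∈ hurwitz, x * g = g * y := by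
  obtain ⟨g, hg, g0, h⟩ := exists_generator M hM hmul hne
  exact ⟨g, hg, g0, h, h _ (hx g hg)⟩

/-- A nonzero real part would kill the imaginary part and make a rational square negative. A Hurwitz
quaternion with real part 0 has integer coordinates. -/
theorem exists_sphere_of_mul_self {d : ℕ} {y : ℍ[ℚ]} (hy : y ∈ hurwitz) (hd : 0 < d)
    (h : y * y = (-(d : ℚ)) • 1) : ∃ v : sphere d, y = toQuat v.1 := by
  have e0 := congrArg QuaternionAlgebra.re h
  have e1 := congrArg QuaternionAlgebra.imI h
  have e2 := congrArg QuaternionAlgebra.imJ h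
  have e3 := congrArg QuaternionAlgebra.imK h
  simp at e0 e1 e2 e3
  have hd' : (0 : ℚ) < d := by exact_mod_cast hd
  have hre : y.re = 0 := by
    by_contra hne
    have k1 : y.imI = 0 := by
      apply (mul_eq_zero.1 (show y.re * y.imI = 0 by linarith)).resolve_left hne
    have k2 : y.imJ = 0 := by
      apply (mul_eq_zero.1 (show y.re * y.imJ = 0 by linarith)).resolve_left hne
    have k3 : y.imK = 0 := by
      apply (mul_eq_zero.1 (show y.re * y.imK = 0 by linarith)).resolve_left hne
    rw [k1, k2, k3] at e0
    nlinarith [mul_self_nonneg y.re]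
  obtain ⟨m, a, b, c, h1, h2, h3, h4⟩ := (mem_hurwitz_iff _).1 hy
  have hm : (m : ℚ) / 2 = 0 := by rw [← h1, hre]
  rw [hm, zero_add] at h2 h3 h4
  refine ⟨⟨![a, b, c], ?_⟩, ?_⟩
  · rw [hre, h2, h3, h4] at e0
    have : ((a ^ 2 + b ^ 2 + c ^ 2 : ℤ) : ℚ) = ((d : ℤ) : ℚ) := by
      push_cast
      linarith
    simpa [sphere] using (by exact_mod_cast this : a ^ 2 + b ^ 2 + c ^ 2 = (d : ℤ))
  · ext <;> simp [hre, h2, h3, h4]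

/-- A rational representation of `d` as a sum of three squares gives an integral one. -/
theorem sphere_nonempty_of_rat {d : ℕ} (hd : 0 < d) {w a b c : ℤ} (hw : w ≠ 0)
    (h : a ^ 2 + b ^ 2 + c ^ 2 = d * w ^ 2) : Nonempty (sphere d) := by
  let z : ℍ[ℚ] := toQuat ![a, b, c]
  let x : ℍ[ℚ] := (w : ℚ)⁻¹ • z
  have hwq : (w : ℚ) ≠ 0 := by exact_mod_cast hw
  have hz : z * z = (-(d * (w : ℚ) ^ 2)) • 1 := by
    have h' : (a : ℚ) ^ 2 + b ^ 2 + c ^ 2 = d * w ^ 2 := by exact_mod_cast h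
    ext <;> simp [z] <;> linarith
  have hxx : x * x = (-(d : ℚ)) • 1 := by
    rw [smul_mul_smul_comm, hz, smul_smul]
    congr 1
    field_simp
  -- The right ideal `w B + z B`. It is stable under left multiplication by `x = z / w`, since `x w
  -- = z` and `x z = -d w`; a generator therefore conjugates `x` into `B`.
  let M : AddSubgroup ℍ[ℚ] :=
    { carrier := {m | ∃ p ∈ hurwitz, ∃ q ∈ hurwitz, m = (w : ℚ) • p + z * q}
      zero_mem' := ⟨0, zero_mem _, 0, zero_mem _, by simp⟩
      add_mem' := by
        rintro _ _ ⟨p, hp, q, hq, rfl⟩ ⟨p', hp', q', hq', rfl⟩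
        exact ⟨p + p', add_mem hp hp', q + q', add_mem hq hq', by rw [smul_add, mul_add]; abel⟩
      neg_mem' := by
        rintro _ ⟨p, hp, q, hq, rfl⟩
        exact ⟨-p, neg_mem hp, -q, neg_mem hq, by rw [smul_neg, mul_neg]; abel⟩ }
  have hM : ∀ m ∈ M, m ∈ hurwitz := by
    rintro _ ⟨p, hp, q, hq, rfl⟩
    exact add_mem (intCast_smul_mem_hurwitz w hp) (mul_mem (toQuat_mem_hurwitz _) hq)
  have hmul : ∀ m ∈ M, ∀ q ∈ hurwitz, m * q ∈ M := by
    rintro _ ⟨p, hp, q, hq, rfl⟩ r hr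
    exact ⟨p * r, mul_mem hp hr, q * r, mul_mem hq hr, by rw [add_mul, smul_mul_assoc, mul_assoc]⟩
  have hx : ∀ m ∈ M, x * m ∈ M := by
    rintro _ ⟨p, hp, q, hq, rfl⟩
    refine ⟨((-(d : ℤ) : ℤ) : ℚ) • q, intCast_smul_mem_hurwitz _ hq, p, hp, ?_⟩
    have e1 : x * ((w : ℚ) • p) = z * p := by
      simp only [x, smul_mul_assoc, mul_smul_comm, smul_smul]
      rw [mul_inv_cancel₀ hwq, one_smul]
    have e2 : x * (z * q) = (w : ℚ) • ((-(d : ℚ)) • q) := by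
      simp only [x, smul_mul_assoc]
      rw [← mul_assoc, hz, smul_mul_assoc, one_mul, smul_smul, smul_smul]
      congr 1
      field_simp
    rw [mul_add, e1, e2]
    push_cast
    exact add_comm _ _
  obtain ⟨g, -, g0, -, y, hy, hxg⟩ := exists_generator_conj M hM hmul
    ⟨(w : ℚ) • (1 : ℍ[ℚ]), ⟨1, one_mem _, 0, zero_mem _, by simp⟩, smul_ne_zero hwq one_ne_zero⟩ hx
  have hyy : y * y = (-(d : ℚ)) • 1 := by
    apply mul_left_cancel₀ g0
    rw [← mul_assoc, ← hxg, mul_assoc, ← hxg, ← mul_assoc, hxx, smul_mul_assoc, one_mul,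
      mul_smul_comm, mul_one]
  obtain ⟨v, -⟩ := exists_sphere_of_mul_self hy hd hyy
  exact ⟨v⟩

/-! ### Sums of three squares -/

/-- Pigeonhole in the style of Thue: impose `X ≡ Y (mod d)` and `X ≡ s W (mod n)`, which make `X² +
n Y² - d W²` divisible by `d n`, with `|X| ≤ √(dn)`, `|Y| ≤ √d`, `|W| ≤ √n`. The size bounds then
leave only the values `0` and `d n`. -/
theorem exists_sq_add_mul_sq_eq {d n : ℕ} (hdn : d.Coprime n) (hd : ¬ IsSquare d)
    (hn : ¬ IsSquare n) (h1 : (d : ℤ) ∣ n + 1) {s : ℤ} (h2 : (n : ℤ) ∣ s ^ 2 - d) :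
    ∃ X Y W : ℤ, W ≠ 0 ∧ X ^ 2 + n * Y ^ 2 = d * W ^ 2 := by
  have hd0 : d ≠ 0 := by rintro rfl; exact hd ⟨0, rfl⟩
  have hn0 : n ≠ 0 := by rintro rfl; exact hn ⟨0, rfl⟩
  have : NeZero d := ⟨hd0⟩
  have : NeZero n := ⟨hn0⟩
  let S := Finset.range ((d * n).sqrt + 1) ×ˢ (Finset.range (d.sqrt + 1) ×ˢ
    Finset.range (n.sqrt + 1))
  let f : ℕ × ℕ × ℕ → ZMod d × ZMod n := fun t => (t.1 - t.2.1, t.1 - s * t.2.2)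
  have hcard : (Finset.univ : Finset (ZMod d × ZMod n)).card < S.card := by
    simp only [Finset.card_univ, Fintype.card_prod, ZMod.card, S, Finset.card_product,
      Finset.card_range]
    have e1 := Nat.lt_succ_sqrt (d * n)
    have e2 := Nat.lt_succ_sqrt d
    have e3 := Nat.lt_succ_sqrt n
    simp only [Nat.succ_eq_add_one] at e1 e2 e3
    have e4 := Nat.mul_lt_mul'' e1 (Nat.mul_lt_mul'' e2 e3)
    -- Compared after squaring: the three sides of the box have squares exceeding `d n`, `d` and
    -- `n`, whose product is `(d n)²`.
    refine lt_of_mul_self_lt_mul_self₀ (Nat.zero_le _) (e4.trans_eq ?_)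
    ring
  obtain ⟨⟨x, y, w⟩, ht, ⟨x', y', w'⟩, ht', hne, hf⟩ :=
    Finset.exists_ne_map_eq_of_card_lt_of_maps_to hcard (f := f) (fun _ _ => Finset.mem_univ _)
  simp only [S, Finset.mem_product, Finset.mem_range] at ht ht'
  simp only [f, Prod.mk.injEq] at hf
  have sq_le : ∀ {a b N : ℕ}, a < N.sqrt + 1 → b < N.sqrt + 1 → ((a : ℤ) - b) ^ 2 ≤ N := by
    intro a b N ha hb
    have h3 : ((N.sqrt : ℤ)) ^ 2 ≤ N := by exact_mod_cast Nat.sqrt_le' N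
    have h4 : ((a : ℤ) - b) ^ 2 ≤ (N.sqrt : ℤ) ^ 2 := by
      apply sq_le_sq'
      · omega
      · omega
    exact h4.trans h3
  have ne_of : ∀ {N : ℕ} {z : ℤ}, ¬ IsSquare N → z ^ 2 ≠ N := by
    intro N z hN h
    apply hN
    refine ⟨z.natAbs, ?_⟩
    zify
    rw [← pow_two, sq_abs, h]
  obtain ⟨X, hX⟩ : ∃ X : ℤ, X = (x : ℤ) - x' := ⟨_, rfl⟩
  obtain ⟨Y, hY⟩ : ∃ Y : ℤ, Y = (y : ℤ) - y' := ⟨_, rfl⟩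
  obtain ⟨W, hW⟩ : ∃ W : ℤ, W = (w : ℤ) - w' := ⟨_, rfl⟩
  have bX : X ^ 2 ≤ d * n := by rw [hX]; exact_mod_cast sq_le ht.1 ht'.1
  have bY : Y ^ 2 < d := lt_of_le_of_ne (by rw [hY]; exact sq_le ht.2.1 ht'.2.1) (ne_of hd)
  have bW : W ^ 2 < n := lt_of_le_of_ne (by rw [hW]; exact sq_le ht.2.2 ht'.2.2) (ne_of hn)
  have cd : (d : ℤ) ∣ X - Y := by
    rw [← ZMod.intCast_zmod_eq_zero_iff_dvd, hX, hY]
    push_cast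
    linear_combination hf.1
  have cn : (n : ℤ) ∣ X - s * W := by
    rw [← ZMod.intCast_zmod_eq_zero_iff_dvd, hX, hW]
    push_cast
    linear_combination hf.2
  have hdvd : (d * n : ℤ) ∣ X ^ 2 + n * Y ^ 2 - d * W ^ 2 := by
    apply IsCoprime.mul_dvd (Nat.isCoprime_iff_coprime.2 hdn)
    · have : X ^ 2 + n * Y ^ 2 - d * W ^ 2 =
          (X - Y) * (X + Y) + (n + 1) * Y ^ 2 - d * W ^ 2 := by ring
      rw [this]
      exact dvd_sub (dvd_add (cd.mul_right _) (h1.mul_right _)) (dvd_mul_right _ _)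
    · have : X ^ 2 + n * Y ^ 2 - d * W ^ 2 =
          (X - s * W) * (X + s * W) + (s ^ 2 - d) * W ^ 2 + n * Y ^ 2 := by ring
      rw [this]
      exact dvd_add (dvd_add (cn.mul_right _) (h2.mul_right _)) (dvd_mul_right _ _)
  obtain ⟨k, hk⟩ := hdvd
  have pd : (0 : ℤ) < d := by exact_mod_cast Nat.pos_of_ne_zero hd0
  have pn : (0 : ℤ) < n := by exact_mod_cast Nat.pos_of_ne_zero hn0
  have pdn : (0 : ℤ) < d * n := mul_pos pd pn
  -- The form lies strictly between `-d n` and `2 d n`; strictness uses that `d` and `n` are not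
  -- squares.
  have k1 : k < 2 := by
    have : (d * n : ℤ) * k < d * n * 2 := by
      rw [← hk]
      nlinarith [sq_nonneg W]
    exact lt_of_mul_lt_mul_left this pdn.le
  have k2 : -1 < k := by
    have : (d * n : ℤ) * (-1) < d * n * k := by
      rw [← hk]
      nlinarith [sq_nonneg X, sq_nonneg Y]
    exact lt_of_mul_lt_mul_left this pdn.le
  obtain rfl | rfl : k = 0 ∨ k = 1 := by omega
  · refine ⟨X, Y, W, fun hW0 => hne ?_, by linarith⟩
    rw [hW0] at hk
    have hY0 : Y = 0 := by
      have : Y ^ 2 = 0 := by nlinarith [sq_nonneg X, sq_nonneg Y]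
      exact pow_eq_zero_iff two_ne_zero |>.1 this
    have hX0 : X = 0 := by
      rw [hY0] at hk
      have : X ^ 2 = 0 := by linarith
      exact pow_eq_zero_iff two_ne_zero |>.1 this
    simp only [Prod.mk.injEq]
    omega
  -- Here `X² + n Y² = d (W² + n)`. Multiply by `W² + n` and use that norms from `ℚ(√-n)` are
  -- multiplicative, to get `d` times a square.
  · refine ⟨X * W - n * Y, X + Y * W, W ^ 2 + n, by positivity, ?_⟩
    linear_combination (W ^ 2 + n) * hk

theorem exists_prime_modEq_modEq {m₁ m₂ a b : ℕ} (h : m₁.Coprime m₂) (h₁ : m₁ ≠ 0) (h₂ : m₂ ≠ 0)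
    (ha : a.Coprime m₁) (hb : b.Coprime m₂) (N : ℕ) :
    ∃ p, N < p ∧ p.Prime ∧ p ≡ a [MOD m₁] ∧ p ≡ b [MOD m₂] := by
  obtain ⟨c, hc1, hc2⟩ := Nat.chineseRemainder h a b
  have hc : c.Coprime (m₁ * m₂) := by
    apply Nat.Coprime.mul_right
    · rw [Nat.Coprime, hc1.gcd_eq]; exact ha
    · rw [Nat.Coprime, hc2.gcd_eq]; exact hb
  obtain ⟨p, hN, hp, hpc⟩ := Nat.forall_exists_prime_gt_and_modEq N (mul_ne_zero h₁ h₂) hc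
  exact ⟨p, hN, hp, (hpc.of_mul_right _).trans hc1, (hpc.of_mul_left _).trans hc2⟩

theorem three_squares_of_sum_two_squares {d n : ℕ} (hdn : d.Coprime n) (hd : ¬ IsSquare d)
    (hn : ¬ IsSquare n) (h1 : (d : ℤ) ∣ n + 1) {s : ℤ} (h2 : (n : ℤ) ∣ s ^ 2 - d)
    (h3 : ∃ u v : ℤ, u ^ 2 + v ^ 2 = n) : Nonempty (sphere d) := by
  obtain ⟨X, Y, W, hW, h⟩ := exists_sq_add_mul_sq_eq hdn hd hn h1 h2
  obtain ⟨u, v, huv⟩ := h3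
  refine sphere_nonempty_of_rat (Nat.pos_of_ne_zero ?_) hW (a := X) (b := u * Y) (c := v * Y) ?_
  · rintro rfl; exact hd ⟨0, rfl⟩
  · rw [← h, ← huv]; ring

theorem exists_sq_sub_dvd {d p : ℕ} (hp : p.Prime) (h : jacobiSym d p = 1) :
    ∃ s : ℤ, (p : ℤ) ∣ s ^ 2 - d := by
  have : Fact p.Prime := ⟨hp⟩
  obtain ⟨r, hr⟩ := ZMod.isSquare_of_jacobiSym_eq_one h
  obtain ⟨s, rfl⟩ := ZMod.intCast_surjective r
  refine ⟨s, ?_⟩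
  rw [← ZMod.intCast_zmod_eq_zero_iff_dvd]
  push_cast at hr ⊢
  rw [hr]
  ring

theorem jacobiSym_of_dvd_add_one {a : ℤ} {e : ℕ} (he : Odd e) (h : (e : ℤ) ∣ a + 1) :
    jacobiSym a e = ZMod.χ₄ e := by
  rw [← jacobiSym.at_neg_one he]
  apply jacobiSym.mod_left'
  apply Int.ModEq.symm
  rw [Int.modEq_iff_dvd]
  simpa using h

theorem exists_sum_two_squares_of_prime {p : ℕ} (hp : p.Prime) (h : p % 4 = 1) :
    ∃ u v : ℤ, u ^ 2 + v ^ 2 = p := by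
  have : Fact p.Prime := ⟨hp⟩
  obtain ⟨u, v, huv⟩ := Nat.Prime.sq_add_sq (p := p) (by omega)
  exact ⟨u, v, by exact_mod_cast huv⟩

theorem dvd_add_one_of_modEq {p e : ℕ} (he : e ≠ 0) (h : p ≡ e - 1 [MOD e]) : (e : ℤ) ∣ p + 1 := by
  have h' := h.add_right 1
  rw [Nat.sub_add_cancel (Nat.pos_of_ne_zero he)] at h'
  have := (Nat.modEq_zero_iff_dvd.1 (h'.trans (by simp [Nat.ModEq])))
  exact_mod_cast this

theorem coprime_sub_one {e : ℕ} (he : e ≠ 0) : (e - 1).Coprime e := by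
  have := Nat.coprime_self_add_right (m := e - 1) (n := 1)
  rw [Nat.sub_add_cancel (Nat.pos_of_ne_zero he)] at this
  exact this.2 (Nat.coprime_one_right _)

/-- Take `n` to be a prime `p ≡ 1 (mod 4)`, or `2 p` if `d ≡ 3 (mod 8)`, with `n ≡ -1 (mod d)`. Then
`n` is a sum of two squares, and reciprocity makes `d` a square modulo `n`. A solution of `X² + n Y²
= d W²` becomes a rational point of the sphere. -/
theorem sphere_nonempty {d : ℕ} (hsq : Squarefree d) (hd : 1 < d) (hd7 : d % 8 ≠ 7) :
    Nonempty (sphere d) := by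
  have hns : ¬ IsSquare d := by
    rintro ⟨r, rfl⟩
    have := hsq r dvd_rfl
    rw [Nat.isUnit_iff] at this
    subst this
    omega
  have hd0 : d ≠ 0 := by omega
  have hd4 : d % 4 ≠ 0 := by
    intro h
    have := hsq 2 (Nat.dvd_of_mod_eq_zero h)
    simp at this
  have prime_ns : ∀ {p : ℕ}, p.Prime → ¬ IsSquare p := fun hp h => hp.prime.not_isSquare h
  by_cases h1 : d % 4 = 1
  · have hodd : Odd d := Nat.odd_iff.2 (by omega)
    obtain ⟨p, hN, hp, hp1, hp2⟩ := exists_prime_modEq_modEq (m₁ := 4) (m₂ := d) (a := 1)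
      (b := d - 1) (Nat.Coprime.pow_left 2 (Nat.coprime_two_left.2 hodd)) (by norm_num) hd0
      (by norm_num) (coprime_sub_one hd0) d
    have hp4 : p % 4 = 1 := hp1
    have hdvd := dvd_add_one_of_modEq hd0 hp2
    obtain ⟨s, hs⟩ := exists_sq_sub_dvd (d := d) hp (by
      rw [jacobiSym.quadratic_reciprocity_one_mod_four h1 (Nat.odd_iff.2 (by omega)),
        jacobiSym_of_dvd_add_one hodd hdvd, ZMod.χ₄_nat_one_mod_four h1])
    exact three_squares_of_sum_two_squares (Nat.coprime_of_lt_prime hd0 hN hp).symm hns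
      (prime_ns hp) hdvd hs (exists_sum_two_squares_of_prime hp hp4)
  by_cases h2 : d % 4 = 2
  · obtain ⟨e, rfl⟩ : 2 ∣ d := by omega
    have hodd : Odd e := Nat.odd_iff.2 (by omega)
    have he0 : e ≠ 0 := by omega
    -- For `p ≡ 1 (mod 4)` and `p ≡ -1 (mod e)` one has `(2e / p) = (2 / p) (p / e) = χ₈(p) χ₄(e)`;
    -- the residue of `p` modulo 8 is chosen to make this 1.
    obtain ⟨r, hr, hr4, hrχ⟩ : ∃ r, r.Coprime 8 ∧ r % 4 = 1 ∧
        ∀ p, p ≡ r [MOD 8] → ZMod.χ₈ p * ZMod.χ₄ e = 1 := by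
      have hχ : ∀ r p : ℕ, p ≡ r [MOD 8] → ((p : ℕ) : ZMod 8) = (r : ℕ) := fun r p h =>
        (ZMod.natCast_eq_natCast_iff _ _ _).2 h
      rcases (show e % 4 = 1 ∨ e % 4 = 3 by omega) with he | he
      · refine ⟨1, by norm_num, by norm_num, fun p h => ?_⟩
        rw [hχ 1 p h, ZMod.χ₄_nat_one_mod_four he]
        decide
      · refine ⟨5, by norm_num, by norm_num, fun p h => ?_⟩
        rw [hχ 5 p h, ZMod.χ₄_nat_three_mod_four he]
        decide
    obtain ⟨p, hN, hp, hp1, hp2⟩ := exists_prime_modEq_modEq (m₁ := 8) (m₂ := e) (a := r)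
      (b := e - 1) (Nat.Coprime.pow_left 3 (Nat.coprime_two_left.2 hodd)) (by norm_num) he0
      hr (coprime_sub_one he0) (2 * e)
    have hp4 : p % 4 = 1 := Eq.trans (hp1.of_dvd (show 4 ∣ 8 by norm_num)) hr4
    have hdvd := dvd_add_one_of_modEq he0 hp2
    obtain ⟨s, hs⟩ := exists_sq_sub_dvd (d := 2 * e) hp (by
      push_cast
      rw [jacobiSym.mul_left, jacobiSym.at_two (Nat.odd_iff.2 (by omega)),
        jacobiSym.quadratic_reciprocity_one_mod_four' hodd hp4,
        jacobiSym_of_dvd_add_one hodd hdvd, hrχ p hp1])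
    refine three_squares_of_sum_two_squares (Nat.coprime_of_lt_prime hd0 hN hp).symm hns
      (prime_ns hp) ?_ hs (exists_sum_two_squares_of_prime hp hp4)
    push_cast
    refine IsCoprime.mul_dvd ?_ (by omega) hdvd
    exact_mod_cast Nat.isCoprime_iff_coprime.2 (Nat.coprime_two_left.2 hodd)
  · have h3 : d % 8 = 3 := by omega
    have hodd : Odd d := Nat.odd_iff.2 (by omega)
    obtain ⟨e, rfl⟩ : ∃ e, d = 2 * e + 1 := ⟨d / 2, by omega⟩
    obtain ⟨p, hN, hp, hp1, hp2⟩ := exists_prime_modEq_modEq (m₁ := 4) (m₂ := 2 * e + 1) (a := 1)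
      (b := e) (Nat.Coprime.pow_left 2 (Nat.coprime_two_left.2 hodd)) (by norm_num) hd0
      (by norm_num) (by simp) (2 * e + 1)
    have hp4 : p % 4 = 1 := hp1
    have hdvd : ((2 * e + 1 : ℕ) : ℤ) ∣ (2 * p : ℕ) + 1 := by
      have h4 := (hp2.mul_left 2).add_right 1
      have := (Nat.modEq_zero_iff_dvd.1 (h4.trans (by simp [Nat.ModEq])))
      exact_mod_cast this
    -- From `2 p ≡ -1 (mod d)`: `(2 / d) (p / d) = (-1 / d) = -1`, while `(2 / d) = -1` because `d ≡
    -- 3 (mod 8)`.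
    have hJ : jacobiSym p (2 * e + 1) = 1 := by
      have h5 := jacobiSym_of_dvd_add_one hodd hdvd
      rw [Nat.cast_mul, Nat.cast_two, jacobiSym.mul_left, jacobiSym.at_two hodd] at h5
      have h6 : ZMod.χ₈ ((2 * e + 1 : ℕ) : ZMod 8) = -1 := by
        have : (((2 * e + 1 : ℕ)) : ZMod 8) = ((3 : ℕ) : ZMod 8) :=
          (ZMod.natCast_eq_natCast_iff _ _ _).2 h3
        rw [this]
        decide
      have h7 := ZMod.χ₄_nat_three_mod_four (n := 2 * e + 1) (by omega)
      push_cast at h5 h6 h7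
      rw [h6, h7] at h5
      linarith
    obtain ⟨s, hs⟩ := exists_sq_sub_dvd (d := 2 * e + 1) hp (by
      rw [jacobiSym.quadratic_reciprocity_one_mod_four' hodd hp4, hJ])
    -- The root must work modulo `2 p`, so it has to be odd like `d`; adding the odd prime `p`
    -- corrects its parity.
    obtain ⟨s', hs', hodd'⟩ : ∃ s' : ℤ, (p : ℤ) ∣ s' ^ 2 - (2 * e + 1 : ℕ) ∧ s' % 2 = 1 := by
      by_cases hs2 : s % 2 = 1
      · exact ⟨s, hs, hs2⟩
      · refine ⟨s + p, ?_, by omega⟩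
        have : (s + p) ^ 2 - ((2 * e + 1 : ℕ) : ℤ) =
          s ^ 2 - ((2 * e + 1 : ℕ) : ℤ) + p * (2 * s + p) := by ring
        rw [this]
        exact dvd_add hs (dvd_mul_right _ _)
    obtain ⟨u, v, huv⟩ := exists_sum_two_squares_of_prime hp hp4
    refine three_squares_of_sum_two_squares (n := 2 * p) (s := s') ?_ hns ?_ hdvd ?_
      ⟨u + v, u - v, by push_cast; rw [← huv]; ring⟩
    · exact Nat.Coprime.mul_right (Nat.coprime_two_right.2 hodd)
        (Nat.coprime_of_lt_prime hd0 hN hp).symm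
    · rintro ⟨r, hr⟩
      have h8 : 2 ∣ r := (Nat.prime_two.dvd_mul.1 ⟨p, hr.symm⟩).elim id id
      obtain ⟨r', rfl⟩ := h8
      have : p = 2 * (r' * r') := by linarith
      omega
    · push_cast
      refine IsCoprime.mul_dvd ?_ ?_ (by exact_mod_cast hs')
      · exact_mod_cast Nat.isCoprime_iff_coprime.2 (Nat.coprime_two_left.2 (Nat.odd_iff.2 (by omega)))
      · obtain ⟨t, rfl⟩ : ∃ t, s' = 2 * t + 1 := ⟨s' / 2, by omega⟩
        exact ⟨2 * t ^ 2 + 2 * t - e, by ring⟩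

/-! ### Norms on the lattices of transporters -/

theorem star_toQuat (v : Fin 3 → ℤ) : star (toQuat v) = - toQuat v := by
  ext <;> simp

section Transporter

variable {d : ℕ} {x y z : sphere d}

theorem star_mem_transporter {l : ℍ[ℚ]} (hl : l ∈ transporter x y) : star l ∈ transporter y x := by
  refine ⟨star_mem_hurwitz hl.1, ?_⟩
  have := congrArg star hl.2
  rw [star_mul, star_mul, star_toQuat, star_toQuat, mul_neg, neg_mul, neg_inj] at this
  exact this.symm

theorem mul_mem_transporter {l m : ℍ[ℚ]} (hl : l ∈ transporter x y) (hm : m ∈ transporter y z) :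
    l * m ∈ transporter x z :=
  ⟨mul_mem hl.1 hm.1, by rw [← mul_assoc, hl.2, mul_assoc, hm.2, mul_assoc]⟩

theorem smul_mem_transporter {l : ℍ[ℚ]} (hl : l ∈ transporter x y) {r : ℚ}
    (h : r • l ∈ hurwitz) : r • l ∈ transporter x y :=
  ⟨h, by rw [mul_smul_comm, smul_mul_assoc, hl.2]⟩

/-- Since `x² = y² = -d`, multiplying `x v + v y` by `x` on the left or by `y` on the right gives `x
v y - d v` both times. -/
theorem add_mem_transporter (x y : sphere d) {v : ℍ[ℚ]} (hv : v ∈ hurwitz) :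
    toQuat x.1 * v + v * toQuat y.1 ∈ transporter x y := by
  refine ⟨add_mem (mul_mem (toQuat_mem_hurwitz _) hv) (mul_mem hv (toQuat_mem_hurwitz _)), ?_⟩
  rw [mul_add, add_mul, ← mul_assoc, toQuat_mul_self, mul_assoc v, toQuat_mul_self, ← mul_assoc]
  simp [add_comm, (Nat.cast_commute d v).eq]

/-- This is `N(xq) + N(qy) + 2⟨xq, qy⟩`, with the inner product written in coordinates. -/
theorem nrm_add_transporter (x y : sphere d) {t u v w : ℤ} {q : ℍ[ℚ]} (h0 : q.re = t)
    (h1 : q.imI = u) (h2 : q.imJ = v) (h3 : q.imK = w) :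
    nrm (toQuat x.1 * q + q * toQuat y.1) =
      2 * d * (t ^ 2 + u ^ 2 + v ^ 2 + w ^ 2) +
      2 * ((x.1 0 * u + x.1 1 * v + x.1 2 * w) * (u * y.1 0 + v * y.1 1 + w * y.1 2) +
      (x.1 0 * t + x.1 1 * w - x.1 2 * v) * (t * y.1 0 + v * y.1 2 - w * y.1 1) +
      (x.1 1 * t + x.1 2 * u - x.1 0 * w) * (t * y.1 1 + w * y.1 0 - u * y.1 2) +
      (x.1 2 * t + x.1 0 * v - x.1 1 * u) * (t * y.1 2 + u * y.1 1 - v * y.1 0)) := by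
  apply nrm_of_eq
  have hx := sphere_cast x
  have hy := sphere_cast y
  rw [Quaternion.normSq_def']
  simp only [Quaternion.re_add, Quaternion.imI_add, Quaternion.imJ_add, Quaternion.imK_add,
    Quaternion.re_mul, Quaternion.imI_mul, Quaternion.imJ_mul, Quaternion.imK_mul, toQuat_re,
    toQuat_imI, toQuat_imJ, toQuat_imK, h0, h1, h2, h3]
  push_cast
  linear_combination ((t : ℚ) ^ 2 + u ^ 2 + v ^ 2 + w ^ 2) * (hx + hy)

theorem not_forall_dvd_of_squarefree (hd : Squarefree d) {p : ℕ} (hp : p.Prime) (x : sphere d) :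
    ¬ ∀ i, (p : ℤ) ∣ x.1 i := by
  intro h
  obtain ⟨a, ha⟩ := h 0
  obtain ⟨b, hb⟩ := h 1
  obtain ⟨c, hc⟩ := h 2
  have hx := x.2
  simp only [sphere, Set.mem_ofPred_eq, ha, hb, hc] at hx
  have : (p * p : ℤ) ∣ d := ⟨a ^ 2 + b ^ 2 + c ^ 2, by rw [← hx]; ring⟩
  have h1 := hd p (by exact_mod_cast this)
  exact hp.one_lt.ne' (Nat.isUnit_iff.1 h1)

/-- If `q ↦ N(xq + qy)` vanished modulo `p` on `1, i, j, k` and their pairwise sums, then linear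
combinations would give `d ≡ 0` and `x_i y_j ≡ 0` for all `i, j`. But `p` divides neither all of `x`
nor all of `y`, as `d` is squarefree. -/
theorem exists_nrm_not_dvd_of_odd_prime (hd : Squarefree d) {p : ℕ} (hp : p.Prime) (hp2 : p ≠ 2)
    (x y : sphere d) : ∃ l ∈ transporter x y, ¬ (p : ℤ) ∣ nrm l := by
  by_contra! H
  have : Fact p.Prime := ⟨hp⟩
  have h2 : (2 : ZMod p) ≠ 0 := by
    intro h
    have : ((2 : ℕ) : ZMod p) = 0 := by exact_mod_cast h
    rw [ZMod.natCast_eq_zero_iff] at this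
    exact hp2 ((Nat.prime_dvd_prime_iff_eq hp Nat.prime_two).1 this)
  have h16 : (16 : ZMod p) ≠ 0 := by
    rw [show (16 : ZMod p) = 2 ^ 4 by norm_num]
    exact pow_ne_zero _ h2
  have key : ∀ t u v w : ℤ, ((2 * d * (t ^ 2 + u ^ 2 + v ^ 2 + w ^ 2) +
      2 * ((x.1 0 * u + x.1 1 * v + x.1 2 * w) * (u * y.1 0 + v * y.1 1 + w * y.1 2) +
      (x.1 0 * t + x.1 1 * w - x.1 2 * v) * (t * y.1 0 + v * y.1 2 - w * y.1 1) +
      (x.1 1 * t + x.1 2 * u - x.1 0 * w) * (t * y.1 1 + w * y.1 0 - u * y.1 2) +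
      (x.1 2 * t + x.1 0 * v - x.1 1 * u) * (t * y.1 2 + u * y.1 1 - v * y.1 0)) : ℤ) : ZMod p)
      = 0 := by
    intro t u v w
    rw [ZMod.intCast_zmod_eq_zero_iff_dvd,
      ← nrm_add_transporter (q := ⟨t, u, v, w⟩) x y rfl rfl rfl rfl]
    refine H _ (add_mem_transporter x y ?_)
    exact (mem_hurwitz_iff _).2 ⟨2 * t, u - t, v - t, w - t, by simp⟩
  push_cast at key
  have r1 := key 1 0 0 0
  have ri := key 0 1 0 0
  have rj := key 0 0 1 0
  have rk := key 0 0 0 1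
  have p1 := key 1 1 0 0
  have p2 := key 1 0 1 0
  have p3 := key 1 0 0 1
  have q1 := key 0 0 1 1
  have q2 := key 0 1 0 1
  have q3 := key 0 1 1 0
  push_cast at r1 ri rj rk p1 p2 p3 q1 q2 q3
  -- The terms `⟨xq, qy⟩` cancel in the sum over `q = 1, i, j, k`, leaving `8 d`.
  have hd0 : (d : ZMod p) = 0 := by
    apply mul_left_cancel₀ h16
    linear_combination 2 * (r1 + ri + rj + rk)
  rw [hd0] at r1 ri rj rk p1 p2 p3 q1 q2 q3
  have hmul : ∀ i j : Fin 3, (x.1 i : ZMod p) * y.1 j = 0 := by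
    intro i j
    apply mul_left_cancel₀ h16
    fin_cases i <;> fin_cases j <;> simp only [Fin.zero_eta, Fin.mk_one, Fin.reduceFinMk]
    · linear_combination 4 * (r1 + ri)
    · linear_combination 2 * (q3 - p3 - ri - rj + r1 + rk)
    · linear_combination 2 * (q2 + p2 - ri - rk - r1 - rj)
    · linear_combination 2 * (q3 + p3 - ri - rj - r1 - rk)
    · linear_combination 4 * (r1 + rj)
    · linear_combination 2 * (q1 - p1 - rj - rk + r1 + ri)
    · linear_combination 2 * (q2 - p2 - ri - rk + r1 + rj)
    · linear_combination 2 * (q1 + p1 - rj - rk - r1 - ri)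
    · linear_combination 4 * (r1 + rk)
  obtain ⟨i, hi⟩ := not_forall.1 (not_forall_dvd_of_squarefree hd hp x)
  obtain ⟨j, hj⟩ := not_forall.1 (not_forall_dvd_of_squarefree hd hp y)
  rw [← ZMod.intCast_zmod_eq_zero_iff_dvd] at hi hj
  exact mul_ne_zero hi hj (hmul i j)

/-- Otherwise every element of the lattice could be halved within the lattice, and the norm of a
nonzero one would descend for ever. -/
theorem exists_nrm_not_dvd_four [Fact (Squarefree d)] (x y : sphere d) :
    ∃ l ∈ transporter x y, ¬ 4 ∣ nrm l := by
  by_contra! H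
  have : ∀ n : ℕ, ∀ l ∈ transporter x y, (nrm l).toNat = n → l = 0 := by
    intro n
    induction n using Nat.strong_induction_on with
    | _ n ih =>
      intro l hl hn
      by_contra hne
      have hpos : 0 < nrm l := lt_of_le_of_ne (nrm_nonneg l) (Ne.symm (mt nrm_eq_zero.1 hne))
      have hh := half_smul_mem_hurwitz hl.1 (H l hl)
      have heq : l = ((2 : ℤ) : ℚ) • ((2⁻¹ : ℚ) • l) := by
        rw [smul_smul]; norm_num
      have h4 : nrm l = 4 * nrm ((2⁻¹ : ℚ) • l) := by
        conv_lhs => rw [heq, nrm_smul_int 2 hh]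
        norm_num
      have h0 := ih _ (by omega) _ (smul_mem_transporter hl hh) rfl
      rw [h0, smul_zero] at heq
      exact hne heq
  obtain ⟨l, hl, hne⟩ := exists_ne_zero_mem_transporter x y
  exact hne (this _ l hl rfl)

theorem nrm_toQuat (x : sphere d) : nrm (toQuat x.1) = d := by
  apply nrm_of_eq
  rw [Quaternion.normSq_def']
  have := sphere_cast x
  simp
  linarith

theorem nrm_one_add_toQuat (x : sphere d) : nrm (1 + toQuat x.1) = 1 + d := by
  apply nrm_of_eq
  rw [Quaternion.normSq_def']
  have := sphere_cast x
  simp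
  linarith

/-- 2 ramifies here: `1 + x` or `x` is an element `π` of `O_x` with norm `2 (mod 4)`. If `N(l)` is
also `2 (mod 4)`, then `π l / 2` is Hurwitz of odd norm. -/
theorem exists_odd_nrm [Fact (Squarefree d)] (h : d % 4 = 1 ∨ d % 4 = 2) (x y : sphere d) :
    ∃ l ∈ transporter x y, ¬ 2 ∣ nrm l := by
  obtain ⟨l, hl, h4⟩ := exists_nrm_not_dvd_four x y
  by_cases h2 : 2 ∣ nrm l
  · obtain ⟨π, hπ, hπn⟩ : ∃ π ∈ transporter x x, nrm π % 4 = 2 := by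
      have hx : toQuat x.1 ∈ transporter x x := ⟨toQuat_mem_hurwitz _, rfl⟩
      rcases h with h | h
      · refine ⟨1 + toQuat x.1, add_mem ⟨one_mem _, by simp⟩ hx, ?_⟩
        rw [nrm_one_add_toQuat]
        omega
      · refine ⟨toQuat x.1, hx, ?_⟩
        rw [nrm_toQuat]
        omega
    obtain ⟨s, hs⟩ := h2
    obtain ⟨t, ht⟩ : 2 ∣ nrm π := by omega
    have hmem := mul_mem_transporter hπ hl
    have hn : nrm (π * l) = 4 * (t * s) := by
      rw [nrm_mul hπ.1 hl.1, hs, ht]; ring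
    have hh := half_smul_mem_hurwitz hmem.1 ⟨_, hn⟩
    refine ⟨_, smul_mem_transporter hmem hh, ?_⟩
    have heq : π * l = ((2 : ℤ) : ℚ) • ((2⁻¹ : ℚ) • (π * l)) := by
      rw [smul_smul]; norm_num
    have h5 : nrm (π * l) = 4 * nrm ((2⁻¹ : ℚ) • (π * l)) := by
      conv_lhs => rw [heq, nrm_smul_int 2 hh]
      norm_num
    have h6 : nrm ((2⁻¹ : ℚ) • (π * l)) = t * s := by linarith
    rw [h6, Int.prime_two.dvd_mul]
    omega
  · exact ⟨l, hl, h2⟩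

theorem nrm_iota_eq (x y : sphere d) (a : ImagQuad d) : nrm (iota x a) = nrm (iota y a) := by
  have hx := sphere_cast x
  have hy := sphere_cast y
  rw [nrm, nrm, Quaternion.normSq_def', Quaternion.normSq_def']
  simp only [iota_re, iota_imI, iota_imJ, iota_imK]
  congr 1
  linear_combination a.im ^ 2 * (hx - hy)

theorem dvd_two_of_dvd_nrm [hd : Fact (Squarefree d)] {n : ℤ}
    (h : ∀ l ∈ transporter x y, n ∣ nrm l) : n ∣ 2 := by
  obtain ⟨l, hl, h4⟩ := exists_nrm_not_dvd_four x y
  have hn4 : ¬ 4 ∣ n := fun h' => h4 (h'.trans (h l hl))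
  have hodd : ∀ p : ℕ, p.Prime → p ∣ n.natAbs → p = 2 := by
    intro p hp hpn
    by_contra hp2
    obtain ⟨m, hm, hpm⟩ := exists_nrm_not_dvd_of_odd_prime hd.out hp hp2 x y
    exact hpm ((Int.natCast_dvd.2 hpn).trans (h m hm))
  have hpow := Nat.eq_prime_pow_of_unique_prime_dvd (n := n.natAbs) (p := 2) (by
    intro h0
    exact hn4 (by rw [Int.natAbs_eq_zero.1 h0]; exact dvd_zero _)) (fun {q} hq hqn => hodd q hq hqn)
  rw [← Int.natAbs_dvd_natAbs, hpow]
  have : n.natAbs.primeFactorsList.length < 2 := by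
    by_contra hge
    apply hn4
    rw [← Int.natAbs_dvd_natAbs, hpow]
    exact pow_dvd_pow 2 (not_lt.1 hge)
  exact (pow_dvd_pow 2 (Nat.le_of_lt_succ this) : 2 ^ _ ∣ 2 ^ 1)

/-- The gcd bound in additive form: a subgroup of `ℤ` is generated by one integer, which here
divides all the norms. -/
theorem two_mem_of_nrm_mem [Fact (Squarefree d)] (S : AddSubgroup ℤ)
    (h : ∀ l ∈ transporter x y, nrm l ∈ S) : 2 ∈ S := by
  obtain ⟨n, rfl⟩ := (AddSubgroup.isAddCyclic_iff_exists_zmultiples_eq_top S).1 inferInstance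
  simp only [Int.mem_zmultiples_iff] at h ⊢
  exact dvd_two_of_dvd_nrm h

theorem one_mem_of_nrm_mem [Fact (Squarefree d)] (S : AddSubgroup ℤ)
    (h : ∀ l ∈ transporter x y, nrm l ∈ S) (hodd : ∃ l ∈ transporter x y, ¬ 2 ∣ nrm l) : 1 ∈ S := by
  obtain ⟨l, hl, h2⟩ := hodd
  have : (1 : ℤ) = nrm l - (nrm l / 2) • 2 := by
    rw [smul_eq_mul]
    omega
  rw [this]
  exact sub_mem (h l hl) (zsmul_mem (two_mem_of_nrm_mem S h) _)

end Transporter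

/-! ### Composition of transporters -/

section Compose

variable {d : ℕ} [Fact (Squarefree d)]

/-- The bilinear map `(l, m) ↦ r l m` on transporters, for a rational number `r` such that it is
integral. -/
noncomputable def scaledMul (x y z : sphere d) (r : ℚ)
    (h : ∀ l ∈ transporter x y, ∀ m ∈ transporter y z, r • (l * m) ∈ hurwitz) :
    transporter x y →ₗ[𝓞 (ImagQuad d)] transporter y z →ₗ[𝓞 (ImagQuad d)] transporter x z :=
  LinearMap.mk₂ _
    (fun l m => ⟨r • (l.1 * m.1),
      smul_mem_transporter (mul_mem_transporter l.2 m.2) (h l l.2 m m.2)⟩)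
    (fun l l' m => Subtype.ext (by
      change r • ((l.1 + l'.1) * m.1) = r • (l.1 * m.1) + r • (l'.1 * m.1)
      rw [add_mul, smul_add]))
    (fun a l m => Subtype.ext (by
      change r • ((iota x a * l.1) * m.1) = iota x a * (r • (l.1 * m.1))
      rw [mul_assoc, mul_smul_comm]))
    (fun l m m' => Subtype.ext (by
      change r • (l.1 * (m.1 + m'.1)) = r • (l.1 * m.1) + r • (l.1 * m'.1)
      rw [mul_add, smul_add]))
    (fun a l m => Subtype.ext (by
      change r • (l.1 * (iota y a * m.1)) = iota x a * (r • (l.1 * m.1))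
      rw [← mul_assoc, ← iota_mul_eq_mul_iota l.2.2, mul_assoc, mul_smul_comm]))

theorem scaledMul_apply {x y z : sphere d} {r : ℚ}
    (h : ∀ l ∈ transporter x y, ∀ m ∈ transporter y z, r • (l * m) ∈ hurwitz)
    (l : transporter x y) (m : transporter y z) :
    (scaledMul x y z r h l m : ℍ[ℚ]) = r • (l.1 * m.1) := rfl

/-- Multiplication of transporters is surjective up to the factor `1` or `2` needed to make it
primitive. -/
theorem exists_scaledMul_surjective (x y z : sphere d) : ∃ (r : ℚ)
    (h : ∀ l ∈ transporter x y, ∀ m ∈ transporter y z, r • (l * m) ∈ hurwitz),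
    Function.Surjective (TensorProduct.lift (scaledMul x y z r h)) := by
  -- The image contains `r N(l) t`, coming from `l ⊗ (l̄ t)`, and `r N(m) t`, coming from `(t m̄) ⊗
  -- m`.
  have left : ∀ (r : ℚ) (h : ∀ l ∈ transporter x y, ∀ m ∈ transporter y z, r • (l * m) ∈ hurwitz)
      (n : ℤ) (t u : transporter x z), u.1 = (r * n) • t.1 →
      (∃ l ∈ transporter x y, n = nrm l) ∨ (∃ m ∈ transporter y z, n = nrm m) →
      u ∈ LinearMap.range (TensorProduct.lift (scaledMul x y z r h)) := by
    rintro r h n t u hu (⟨l, hl, rfl⟩ | ⟨m, hm, rfl⟩)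
    · refine ⟨(⟨l, hl⟩ : transporter x y) ⊗ₜ
        ⟨star l * t.1, mul_mem_transporter (star_mem_transporter hl) t.2⟩, Subtype.ext ?_⟩
      rw [TensorProduct.lift.tmul, scaledMul_apply, hu, ← mul_assoc, mul_star_eq_nrm hl.1,
        smul_mul_assoc, one_mul, smul_smul]
    · refine ⟨(⟨t.1 * star m, mul_mem_transporter t.2 (star_mem_transporter hm)⟩ :
        transporter x y) ⊗ₜ ⟨m, hm⟩, Subtype.ext ?_⟩
      rw [TensorProduct.lift.tmul, scaledMul_apply, hu, mul_assoc, star_mul_eq_nrm hm.1,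
        mul_smul_comm, mul_one, smul_smul]
  -- The integers `n` with `r n t` in the image form a subgroup, so norms can be combined
  -- additively; the aim is `r n = 1`.
  let S (r : ℚ) (h : ∀ l ∈ transporter x y, ∀ m ∈ transporter y z, r • (l * m) ∈ hurwitz)
      (t : transporter x z) : AddSubgroup ℤ :=
    { carrier := {n | ∃ u ∈ LinearMap.range (TensorProduct.lift (scaledMul x y z r h)),
        u.1 = (r * n) • t.1}
      zero_mem' := ⟨0, zero_mem _, by simp⟩
      add_mem' := by
        rintro m n ⟨u, hu, h1⟩ ⟨v, hv, h2⟩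
        refine ⟨u + v, add_mem hu hv, ?_⟩
        change u.1 + v.1 = _
        rw [h1, h2, ← add_smul, Int.cast_add, mul_add]
      neg_mem' := by
        rintro m ⟨u, hu, h1⟩
        refine ⟨-u, neg_mem hu, ?_⟩
        change -u.1 = _
        rw [h1, ← neg_smul, Int.cast_neg, mul_neg] }
  have hS : ∀ (r : ℚ) (h) (t : transporter x z) (n : ℤ),
      (∃ l ∈ transporter x y, n = nrm l) ∨ (∃ m ∈ transporter y z, n = nrm m) → n ∈ S r h t := by
    intro r h t n hn
    have hmem : (r * n) • t.1 ∈ hurwitz := by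
      rcases hn with ⟨l, hl, rfl⟩ | ⟨m, hm, rfl⟩
      · have := h l hl _ (mul_mem_transporter (star_mem_transporter hl) t.2)
        rwa [← mul_assoc, mul_star_eq_nrm hl.1, smul_mul_assoc, one_mul, smul_smul] at this
      · have := h _ (mul_mem_transporter t.2 (star_mem_transporter hm)) m hm
        rwa [mul_assoc, star_mul_eq_nrm hm.1, mul_smul_comm, mul_one, smul_smul] at this
    exact ⟨⟨_, smul_mem_transporter t.2 hmem⟩, left r h n t _ rfl hn, rfl⟩
  -- With an odd norm on either side, `r = 1` works and `1 ∈ S`. Otherwise all products have norm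
  -- divisible by 4, so `r = 1/2` is integral and `2 ∈ S` suffices.
  by_cases hodd : (∃ l ∈ transporter x y, ¬ 2 ∣ nrm l) ∨ (∃ m ∈ transporter y z, ¬ 2 ∣ nrm m)
  · refine ⟨1, fun l hl m hm => by rw [one_smul]; exact mul_mem hl.1 hm.1, fun t => ?_⟩
    obtain ⟨u, ⟨w, hw⟩, hu⟩ : 1 ∈ S 1 _ t := by
      rcases hodd with hodd | hodd
      · exact one_mem_of_nrm_mem _ (fun l hl => hS _ _ _ _ (Or.inl ⟨l, hl, rfl⟩)) hodd
      · exact one_mem_of_nrm_mem _ (fun l hl => hS _ _ _ _ (Or.inr ⟨l, hl, rfl⟩)) hodd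
    refine ⟨w, hw.trans (Subtype.ext ?_)⟩
    rw [hu]
    norm_num
  · push Not at hodd
    refine ⟨2⁻¹, fun l hl m hm => half_smul_mem_hurwitz (mul_mem hl.1 hm.1) ?_, fun t => ?_⟩
    · rw [nrm_mul hl.1 hm.1]
      exact mul_dvd_mul (hodd.1 l hl) (hodd.2 m hm)
    · obtain ⟨u, ⟨w, hw⟩, hu⟩ : 2 ∈ S 2⁻¹ _ t :=
        two_mem_of_nrm_mem _ (fun l hl => hS _ _ _ _ (Or.inl ⟨l, hl, rfl⟩))
      refine ⟨w, hw.trans (Subtype.ext ?_)⟩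
      rw [hu]
      norm_num

/-- A surjection between invertible modules is bijective. Being a scalar multiple of the quaternion
product, the map visibly respects both outer actions. -/
theorem exists_bimodule_equiv (x y z : sphere d) :
    ∃ φ : transporter x y ⊗[𝓞 (ImagQuad d)] transporter y z ≃ₗ[𝓞 (ImagQuad d)] transporter x z,
      (∀ a ∈ order x, ∀ (l l' : transporter x y) (m : transporter y z),
        (l' : ℍ[ℚ]) = a * l → (φ (l' ⊗ₜ m) : ℍ[ℚ]) = a * φ (l ⊗ₜ m)) ∧
      (∀ b ∈ order z, ∀ (l : transporter x y) (m m' : transporter y z),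
        (m' : ℍ[ℚ]) = m * b → (φ (l ⊗ₜ m') : ℍ[ℚ]) = φ (l ⊗ₜ m) * b) := by
  obtain ⟨r, h, hsurj⟩ := exists_scaledMul_surjective x y z
  refine ⟨LinearEquiv.ofBijective _ (Module.Invertible.bijective_of_surjective hsurj), ?_, ?_⟩
  · intro a _ l l' m hl
    simp only [LinearEquiv.ofBijective_apply, TensorProduct.lift.tmul, scaledMul_apply]
    rw [hl, mul_assoc, mul_smul_comm]
  · intro b _ l m m' hm
    simp only [LinearEquiv.ofBijective_apply, TensorProduct.lift.tmul, scaledMul_apply]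
    rw [hm, ← mul_assoc, smul_mul_assoc]

theorem latticeClass_mul (x y z : sphere d) :
    latticeClass x y * latticeClass y z = latticeClass x z := by
  obtain ⟨φ, -⟩ := exists_bimodule_equiv x y z
  rw [latticeClass, latticeClass, latticeClass, ← map_mul, ← CommRing.Pic.mk_tensor]
  exact congrArg _ (CommRing.Pic.mk_eq_mk_iff.2 ⟨φ⟩)

/-! ### Computing the class of a transporter -/

theorem latticeClass_eq_mk0 {x y : sphere d}
    (F : transporter x y →ₗ[𝓞 (ImagQuad d)] 𝓞 (ImagQuad d)) (hF : Function.Injective F)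
    (I : (Ideal (𝓞 (ImagQuad d)))⁰) (hI : LinearMap.range F = I.1) :
    latticeClass x y = ClassGroup.mk0 I := by
  have := invertible_of_ne_bot (nonZeroDivisors.coe_ne_zero I)
  rw [latticeClass, MulEquiv.symm_apply_eq, equivPic_mk0, CommRing.Pic.mk_eq_mk_iff]
  exact ⟨(LinearEquiv.ofInjective F hF).trans (LinearEquiv.ofEq _ _ hI)⟩

/-- Right multiplication by `c` from a transporter to the ring of integers, when it is integral. -/
theorem exists_linearMap_of_mul_right {x y : sphere d} {c : ℍ[ℚ]} (hc : c ≠ 0)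
    (h : ∀ l ∈ transporter x y, ∃ a : 𝓞 (ImagQuad d), iota x a = l * c) :
    ∃ F : transporter x y →ₗ[𝓞 (ImagQuad d)] 𝓞 (ImagQuad d), Function.Injective F ∧
      ∀ l, iota x (F l) = l.1 * c := by
  have hinj : Function.Injective (iota x) := (iota x).toRingHom.injective
  choose! f hf using h
  refine ⟨{ toFun := fun l => f l.1, map_add' := fun l l' => ?_, map_smul' := fun a l => ?_ },
    fun l l' hl => ?_, fun l => hf l.1 l.2⟩
  · apply NumberField.RingOfIntegers.ext
    apply hinj
    change iota x (f (l + l' : transporter x y) : ImagQuad d) =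
      iota x ((f l : ImagQuad d) + f l')
    rw [map_add, hf _ (l + l').2, hf _ l.2, hf _ l'.2]
    exact add_mul _ _ _
  · apply NumberField.RingOfIntegers.ext
    apply hinj
    change iota x (f (a • l : transporter x y) : ImagQuad d) = iota x ((a : ImagQuad d) * f l)
    rw [map_mul, hf _ (a • l).2, hf _ l.2, coe_smul_eq, mul_assoc]
  · have hl' : f l.1 = f l'.1 := hl
    have := hf l.1 l.2
    rw [hl', hf _ l'.2] at this
    exact Subtype.ext (mul_right_cancel₀ hc this).symm

theorem exists_iota_of_mem_self {x : sphere d} {q : ℍ[ℚ]} (hq : q ∈ transporter x x) :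
    ∃ a : 𝓞 (ImagQuad d), iota x a = q := by
  obtain ⟨z, rfl⟩ := exists_iota_of_commute x hq.2
  exact ⟨⟨z, (iota_mem_hurwitz_iff x z).1 hq.1⟩, rfl⟩

theorem iota_mem_self (x : sphere d) (a : 𝓞 (ImagQuad d)) : iota x a ∈ transporter x x :=
  ⟨(iota_mem_hurwitz_iff x a).2 a.isIntegral_coe,
    (iota_mul_eq_mul_iota (x := x) (y := x) rfl _).symm⟩

theorem exists_generator_of_latticeClass_eq_one {x y : sphere d} (h : latticeClass x y = 1) :
    ∃ g ∈ transporter x y, ∀ l ∈ transporter x y, ∃ a : 𝓞 (ImagQuad d), l = iota x a * g := by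
  rw [latticeClass, MulEquiv.symm_apply_eq, map_one, CommRing.Pic.mk_eq_one_iff] at h
  obtain ⟨e⟩ := h
  refine ⟨(e.symm 1).1, (e.symm 1).2, fun l hl => ⟨e ⟨l, hl⟩, ?_⟩⟩
  rw [← coe_smul_eq, ← map_smul, smul_eq_mul, mul_one, LinearEquiv.symm_apply_apply]

/-- Each `l g⁻¹` commutes with `x`; being integral it lies in `O_x`, so the lattice is `O_x g`. -/
theorem latticeClass_eq_one_of_generator {x y : sphere d} {g : ℍ[ℚ]} (hg : g ∈ transporter x y)
    (g0 : g ≠ 0) (h : ∀ l ∈ transporter x y, l * g⁻¹ ∈ hurwitz) : latticeClass x y = 1 := by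
  have hgi : toQuat y.1 * g⁻¹ = g⁻¹ * toQuat x.1 := by
    rw [eq_inv_mul_iff_mul_eq₀ g0, ← mul_assoc, ← hg.2, mul_inv_cancel_right₀ g0]
  obtain ⟨F, hF, hFl⟩ := exists_linearMap_of_mul_right (x := x) (y := y) (inv_ne_zero g0)
    (fun l hl => exists_iota_of_mem_self ⟨h l hl, by rw [← mul_assoc, hl.2, mul_assoc, hgi, mul_assoc]⟩)
  rw [latticeClass_eq_mk0 F hF 1, map_one]
  change _ = (1 : Ideal (𝓞 (ImagQuad d)))
  rw [Ideal.one_eq_top, LinearMap.range_eq_top]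
  intro a
  refine ⟨⟨iota x a * g, mul_mem_transporter (iota_mem_self x a) hg⟩, ?_⟩
  apply NumberField.RingOfIntegers.ext
  apply (iota x).toRingHom.injective
  change iota x _ = iota x _
  rw [hFl, mul_inv_cancel_right₀ g0]

/-- If some transporter from `x` to `y` has norm `2`, then the class of the lattice of transporters
is that of a prime above `2`, namely the ideal of elements of even norm. -/
theorem exists_prime_of_nrm_eq_two {x y : sphere d} {g : ℍ[ℚ]} (hg : g ∈ transporter x y)
    (hn : nrm g = 2) : ∃ P : (Ideal (𝓞 (ImagQuad d)))⁰, IsPrimeAboveTwo P ∧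
      latticeClass x y = ClassGroup.mk0 P ∧ ∀ a, a ∈ P.1 ↔ 2 ∣ nrm (iota x a) := by
  have g0 : g ≠ 0 := fun h0 => by simp [nrm_eq_zero.2 h0] at hn
  obtain ⟨F, hF, hFl⟩ := exists_linearMap_of_mul_right (x := x) (y := y) (star_ne_zero.2 g0)
    (fun l hl => exists_iota_of_mem_self (mul_mem_transporter hl (star_mem_transporter hg)))
  have hinj : Function.Injective (iota x) := (iota x).toRingHom.injective
  let J : Ideal (𝓞 (ImagQuad d)) := LinearMap.range F
  have mem_J : ∀ a : 𝓞 (ImagQuad d), a ∈ J ↔ 2 ∣ nrm (iota x a) := by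
    intro a
    have ha := iota_mem_self x a
    constructor
    · rintro ⟨l, rfl⟩
      rw [hFl, nrm_mul l.2.1 (star_mem_hurwitz hg.1), nrm_star, hn]
      exact dvd_mul_left _ _
    -- The preimage of `a` under `l ↦ l ḡ` is `a g / 2`, which is Hurwitz because `N(a g) = 2 N(a)`
    -- is divisible by 4.
    · intro h
      have hag := mul_mem_transporter ha hg
      have hh := half_smul_mem_hurwitz hag.1 (by
        rw [nrm_mul ha.1 hg.1, hn]
        exact mul_dvd_mul h dvd_rfl)
      refine ⟨⟨_, smul_mem_transporter hag hh⟩, ?_⟩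
      apply NumberField.RingOfIntegers.ext
      apply hinj
      rw [hFl, smul_mul_assoc, mul_assoc, mul_star_eq_nrm hg.1, hn, mul_smul_comm, mul_one,
        smul_smul]
      norm_num
  have h2 : (2 : 𝓞 (ImagQuad d)) ∈ J := by
    rw [mem_J]
    have : iota x ((2 : 𝓞 (ImagQuad d)) : ImagQuad d) = ((2 : ℤ) : ℚ) • 1 := by
      rw [show ((2 : 𝓞 (ImagQuad d)) : ImagQuad d) = 2 from rfl, map_ofNat]
      norm_num [ofNat_smul_eq_nsmul]
    rw [this, nrm_smul_int _ (one_mem _), nrm_one]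
    norm_num
  have h1 : (1 : 𝓞 (ImagQuad d)) ∉ J := by
    rw [mem_J]
    have : iota x ((1 : 𝓞 (ImagQuad d)) : ImagQuad d) = 1 := map_one _
    rw [this, nrm_one]
    norm_num
  have h20 : (2 : 𝓞 (ImagQuad d)) ≠ 0 := two_ne_zero
  have hJ0 : J ∈ (Ideal (𝓞 (ImagQuad d)))⁰ := by
    rw [mem_nonZeroDivisors_iff_ne_zero]
    intro h
    rw [h] at h2
    exact h20 h2
  have hprime : J.IsPrime := by
    refine ⟨fun h => h1 (h ▸ Submodule.mem_top), fun {a b} hab => ?_⟩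
    rw [mem_J] at hab ⊢
    rw [mem_J]
    have : iota x ((a * b : 𝓞 (ImagQuad d)) : ImagQuad d) = iota x a * iota x b := by
      rw [← map_mul]; rfl
    rw [this, nrm_mul (iota_mem_self x a).1 (iota_mem_self x b).1] at hab
    exact Int.prime_two.dvd_or_dvd hab
  exact ⟨⟨J, hJ0⟩, ⟨hprime, h2⟩, latticeClass_eq_mk0 F hF ⟨J, hJ0⟩ rfl, mem_J⟩

/-- Both classes are that of the ideal of elements of even norm, and the norm on the field does not
depend on the embedding. -/
theorem latticeClass_eq_of_nrm_eq_two {x y x' y' : sphere d} {g g' : ℍ[ℚ]}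
    (hg : g ∈ transporter x y) (hn : nrm g = 2) (hg' : g' ∈ transporter x' y')
    (hn' : nrm g' = 2) : latticeClass x y = latticeClass x' y' := by
  obtain ⟨P, -, h, hP⟩ := exists_prime_of_nrm_eq_two hg hn
  obtain ⟨P', -, h', hP'⟩ := exists_prime_of_nrm_eq_two hg' hn'
  have : P = P' := Subtype.ext (Ideal.ext fun a => by rw [hP, hP', nrm_iota_eq x x'])
  rw [h, h', this]

end Compose

/-! ### Generators of trivial classes, and realisation of every class -/

section Classes

variable {d : ℕ} [hd : Fact (Squarefree d)]

theorem exists_int_nrm_iota (x : sphere d) (a : 𝓞 (ImagQuad d)) : ∃ m l : ℤ,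
    (a : ImagQuad d).re = m / 2 ∧ (a : ImagQuad d).im = l / 2 ∧
    m ^ 2 + d * l ^ 2 = 4 * nrm (iota x a) := by
  obtain ⟨m, l, n, hm, hl, hmn⟩ := exists_int_of_isIntegral a.isIntegral_coe
  refine ⟨m, l, hm, hl, ?_⟩
  rw [hmn, nrm_of_eq (n := n)]
  rw [Quaternion.normSq_def', iota_re, iota_imI, iota_imJ, iota_imK, hm, hl]
  have hx := sphere_cast x
  have : (m : ℚ) ^ 2 + d * l ^ 2 = 4 * n := by exact_mod_cast hmn
  linear_combination (1 / 4 : ℚ) * this + (l / 2 : ℚ) ^ 2 * hx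

/-- 2 is inert when `d ≡ 3 (mod 8)`. Concretely, `m² + d l²` is odd for opposite parities and `4
(mod 8)` when both are odd, so `m² + d l² = 8 k` forces `m` and `l` even; the same dichotomy then
applies to their halves. -/
theorem four_dvd_nrm_iota (h8 : d % 8 = 3) (x : sphere d) (a : 𝓞 (ImagQuad d))
    (h : 2 ∣ nrm (iota x a)) : 4 ∣ nrm (iota x a) := by
  obtain ⟨m, l, -, -, hml⟩ := exists_int_nrm_iota x a
  obtain ⟨e, he⟩ : ∃ e : ℤ, (d : ℤ) = 8 * e + 3 := ⟨d / 8, by omega⟩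
  obtain ⟨k, hk⟩ := h
  rw [he, hk] at hml
  rw [hk]
  have odd_sq : ∀ s : ℤ, ∃ t, (2 * s + 1) ^ 2 = 8 * t + 1 := by
    intro s
    obtain ⟨t, ht⟩ := Int.even_mul_succ_self s
    exact ⟨t, by linear_combination 4 * ht⟩
  have par : ∀ m l : ℤ, 2 ∣ m ^ 2 + (8 * e + 3) * l ^ 2 →
      (∃ m' l', m = 2 * m' ∧ l = 2 * l') ∨ ∃ t, m ^ 2 + (8 * e + 3) * l ^ 2 = 8 * t + 4 := by
    intro m l h
    obtain ⟨m', rfl | rfl⟩ := Int.even_or_odd' m <;> obtain ⟨l', rfl | rfl⟩ := Int.even_or_odd' l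
    · exact Or.inl ⟨m', l', rfl, rfl⟩
    · exfalso
      obtain ⟨t, ht⟩ := odd_sq l'
      obtain ⟨r, hr⟩ := h
      rw [ht] at hr
      have : (2 * (2 * m' ^ 2) + 2 * ((8 * e + 3) * 4 * t + 4 * e + 1) + 1 : ℤ) = 2 * r := by
        rw [← hr]; ring
      omega
    · exfalso
      obtain ⟨t, ht⟩ := odd_sq m'
      obtain ⟨r, hr⟩ := h
      rw [ht] at hr
      have : (2 * (4 * t) + 1 + 2 * ((8 * e + 3) * (2 * l' ^ 2)) : ℤ) = 2 * r := by
        rw [← hr]; ring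
      omega
    · right
      obtain ⟨t, ht⟩ := odd_sq m'
      obtain ⟨r, hr⟩ := odd_sq l'
      exact ⟨t + (8 * e + 3) * r + e, by rw [ht, hr]; ring⟩
  rcases par m l ⟨2 * (2 * k), by rw [hml]; ring⟩ with ⟨m', l', rfl, rfl⟩ | ⟨t, ht⟩
  · have h2 : m' ^ 2 + (8 * e + 3) * l' ^ 2 = 2 * k := by linarith
    rcases par m' l' ⟨k, h2⟩ with ⟨m'', l'', rfl, rfl⟩ | ⟨t, ht⟩
    · exact ⟨m'' ^ 2 + (8 * e + 3) * l'' ^ 2, by rw [← h2]; ring⟩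
    · exact ⟨2 * t + 1, by rw [← h2, ht]; ring⟩
  · omega

theorem latticeClass_eq_one_of_nrm_one {x y : sphere d} {g : ℍ[ℚ]} (hg : g ∈ transporter x y)
    (hn : nrm g = 1) : latticeClass x y = 1 := by
  have g0 : g ≠ 0 := fun h0 => by simp [nrm_eq_zero.2 h0] at hn
  refine latticeClass_eq_one_of_generator hg g0 fun l hl => ?_
  have : g⁻¹ = star g := by
    apply inv_eq_of_mul_eq_one_right
    rw [mul_star_eq_nrm hg.1, hn, Int.cast_one, one_smul]
  rw [this]
  exact mul_mem hl.1 (star_mem_hurwitz hg.1)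

/-- For `l` in the lattice, `l ḡ` lies in `O_x` and has even norm, hence norm divisible by 4. So `l
g⁻¹ = l ḡ / 2` is integral and `g` is a generator. -/
theorem latticeClass_eq_one_of_nrm_two (h8 : d % 8 = 3) {x y : sphere d} {g : ℍ[ℚ]}
    (hg : g ∈ transporter x y) (hn : nrm g = 2) : latticeClass x y = 1 := by
  have g0 : g ≠ 0 := fun h0 => by simp [nrm_eq_zero.2 h0] at hn
  refine latticeClass_eq_one_of_generator hg g0 fun l hl => ?_
  have : g⁻¹ = (2⁻¹ : ℚ) • star g := by
    apply inv_eq_of_mul_eq_one_right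
    rw [mul_smul_comm, mul_star_eq_nrm hg.1, hn, smul_smul]
    norm_num
  have hmem := mul_mem_transporter hl (star_mem_transporter hg)
  obtain ⟨a, ha⟩ := exists_iota_of_mem_self hmem
  rw [this, mul_smul_comm]
  refine half_smul_mem_hurwitz hmem.1 ?_
  rw [← ha]
  apply four_dvd_nrm_iota h8
  rw [ha, nrm_mul hl.1 (star_mem_hurwitz hg.1), nrm_star, hn]
  exact dvd_mul_left _ _

/-- The norm of a generator divides every norm on the lattice, hence divides 2; it is not 2 when an
odd norm occurs. -/
theorem exists_nrm_of_latticeClass_eq_one {x y : sphere d} (h : latticeClass x y = 1) :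
    ∃ g ∈ transporter x y, (nrm g = 1 ∨ nrm g = 2) ∧ (d % 4 = 1 ∨ d % 4 = 2 → nrm g = 1) := by
  obtain ⟨g, hg, hgen⟩ := exists_generator_of_latticeClass_eq_one h
  have hdvd : ∀ l ∈ transporter x y, nrm g ∣ nrm l := by
    intro l hl
    obtain ⟨a, rfl⟩ := hgen l hl
    rw [nrm_mul (iota_mem_self x a).1 hg.1]
    exact dvd_mul_left _ _
  have h2 := dvd_two_of_dvd_nrm hdvd
  have h0 := nrm_nonneg g
  have hle := Int.le_of_dvd (by norm_num) h2
  have hne : nrm g ≠ 0 := by rintro h; rw [h] at h2; norm_num at h2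
  refine ⟨g, hg, by omega, fun hd' => ?_⟩
  obtain ⟨l, hl, hodd⟩ := exists_odd_nrm hd' x y
  have : nrm g ≠ 2 := fun h => hodd (h ▸ hdvd l hl)
  omega

/-- With `I B = g B` and `y = g⁻¹ x g`, one has `Λ_{x→y} = I⁻¹ g`. So `I` is taken in the class
inverse to that of `J`, and `I J = (α)` turns `I⁻¹` into `α⁻¹ J`. -/
theorem exists_latticeClass_eq (x : sphere d) (g : ClassGroup (𝓞 (ImagQuad d))) :
    ∃ y : sphere d, latticeClass x y = g := by
  obtain ⟨J, rfl⟩ := ClassGroup.mk0_surjective g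
  obtain ⟨I, hI⟩ := ClassGroup.mk0_surjective (ClassGroup.mk0 J)⁻¹
  obtain ⟨α, hα⟩ : ∃ α, I.1 * J.1 = Ideal.span {α} := by
    have h1 : ClassGroup.mk0 (I * J) = 1 := by rw [map_mul, hI, inv_mul_cancel]
    obtain ⟨α, hα⟩ := (ClassGroup.mk0_eq_one_iff (I * J).2).1 h1
    exact ⟨α, hα⟩
  have hinj : Function.Injective (iota x) := (iota x).toRingHom.injective
  have hI0 : I.1 ≠ ⊥ := nonZeroDivisors.coe_ne_zero I
  have hα0 : α ≠ 0 := by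
    rintro rfl
    rw [Ideal.span_singleton_eq_bot.2 rfl] at hα
    exact mul_ne_zero hI0 (nonZeroDivisors.coe_ne_zero J) hα
  have hα0' : (α : ImagQuad d) ≠ 0 := by
    simpa using hα0
  have hαx : iota x α ≠ 0 := fun h => hα0' (hinj (h.trans (map_zero _).symm))
  have coe_mul : ∀ a b : 𝓞 (ImagQuad d), iota x ((a * b : 𝓞 (ImagQuad d)) : ImagQuad d) =
      iota x a * iota x b := fun a b => by rw [← map_mul]; rfl
  let M : AddSubgroup ℍ[ℚ] :=
    AddSubgroup.closure {m | ∃ a ∈ I.1, ∃ q ∈ hurwitz, m = iota x a * q}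
  have subM : ∀ a ∈ I.1, ∀ q ∈ hurwitz, iota x a * q ∈ M := fun a ha q hq =>
    AddSubgroup.subset_closure ⟨a, ha, q, hq, rfl⟩
  have hM : ∀ m ∈ M, m ∈ hurwitz := by
    intro m hm
    have hle : M ≤ hurwitz.toAddSubgroup := by
      rw [AddSubgroup.closure_le]
      rintro _ ⟨a, -, q, hq, rfl⟩
      exact hurwitz.mul_mem (iota_mem_self x a).1 hq
    exact hle hm
  have hmul : ∀ m ∈ M, ∀ q ∈ hurwitz, m * q ∈ M := by
    intro m hm q hq
    have hle : M ≤ M.comap (AddMonoidHom.mulRight q) := by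
      rw [AddSubgroup.closure_le]
      rintro _ ⟨a, ha, r, hr, rfl⟩
      change iota x a * r * q ∈ M
      rw [mul_assoc]
      exact subM a ha _ (mul_mem hr hq)
    exact hle hm
  have hne : ∃ m ∈ M, m ≠ 0 := by
    obtain ⟨a, ha, ha0⟩ := Submodule.exists_mem_ne_zero_of_ne_bot hI0
    refine ⟨_, subM a ha 1 (one_mem _), ?_⟩
    rw [mul_one]
    intro h
    apply ha0
    apply NumberField.RingOfIntegers.ext
    exact hinj (h.trans (map_zero _).symm)
  have hx : ∀ m ∈ M, toQuat x.1 * m ∈ M := by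
    obtain ⟨s, hs⟩ := exists_iota_of_mem_self (x := x) ⟨toQuat_mem_hurwitz x.1, rfl⟩
    intro m hm
    have hle : M ≤ M.comap (AddMonoidHom.mulLeft (toQuat x.1)) := by
      rw [AddSubgroup.closure_le]
      rintro _ ⟨a, ha, r, hr, rfl⟩
      change toQuat x.1 * (iota x a * r) ∈ M
      rw [← mul_assoc, ← hs, ← coe_mul]
      exact subM _ (I.1.mul_mem_left s ha) _ hr
    exact hle hm
  obtain ⟨g, hg, g0, hgen, y, hy, hxg⟩ := exists_generator_conj M hM hmul hne hx
  obtain ⟨v, rfl⟩ : ∃ v : sphere d, y = toQuat v.1 := by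
    refine exists_sphere_of_mul_self hy (by exact_mod_cast sphere_pos (d := d)) ?_
    apply mul_left_cancel₀ g0
    rw [← mul_assoc, ← hxg, mul_assoc, ← hxg, ← mul_assoc, toQuat_mul_self, zero_smul, add_zero,
      smul_mul_assoc, one_mul, mul_smul_comm, mul_one]
  have hgi : toQuat v.1 * g⁻¹ = g⁻¹ * toQuat x.1 := by
    rw [eq_inv_mul_iff_mul_eq₀ g0, ← mul_assoc, ← hxg, mul_inv_cancel_right₀ g0]
  -- Write `l g⁻¹ = k` in the field. As `I ⊆ g B`, `k I` is integral, so `k I J ⊆ J` and in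
  -- particular `k α ∈ J`.
  have key : ∀ l ∈ transporter x v, ∃ b ∈ J.1, iota x b = l * (g⁻¹ * iota x α) := by
    intro l hl
    obtain ⟨k, hk⟩ := exists_iota_of_commute x (q := l * g⁻¹) (by
      rw [← mul_assoc, hl.2, mul_assoc, hgi, mul_assoc])
    have hkI : ∀ a ∈ I.1, ∃ r : 𝓞 (ImagQuad d), (r : ImagQuad d) = k * a := by
      intro a ha
      obtain ⟨q, hq, hq'⟩ := hgen _ (subM a ha 1 (one_mem _))
      have hmem : iota x (k * a) ∈ hurwitz := by
        rw [map_mul, hk, ← mul_one (iota x a), hq', ← mul_assoc, inv_mul_cancel_right₀ g0]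
        exact mul_mem hl.1 hq
      exact ⟨⟨_, (iota_mem_hurwitz_iff x _).1 hmem⟩, rfl⟩
    have hkIJ : ∀ β ∈ I.1 * J.1, ∃ b ∈ J.1, (b : ImagQuad d) = k * β := by
      intro β hβ
      induction hβ using Submodule.mul_induction_on' with
      | mem_mul_mem a ha b hb =>
        obtain ⟨r, hr⟩ := hkI a ha
        refine ⟨r * b, J.1.mul_mem_left r hb, ?_⟩
        change (r : ImagQuad d) * b = k * (a * b)
        rw [hr, mul_assoc]
      | add a _ b _ iha ihb =>
        obtain ⟨r, hr, hr'⟩ := iha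
        obtain ⟨s, hs, hs'⟩ := ihb
        refine ⟨r + s, add_mem hr hs, ?_⟩
        change (r : ImagQuad d) + s = k * (a + b)
        rw [hr', hs', mul_add]
    obtain ⟨b, hb, hbk⟩ := hkIJ α (by rw [hα]; exact Ideal.mem_span_singleton_self α)
    refine ⟨b, hb, ?_⟩
    rw [hbk, map_mul, hk, mul_assoc]
  obtain ⟨F, hF, hFl⟩ := exists_linearMap_of_mul_right (x := x) (y := v)
    (mul_ne_zero (inv_ne_zero g0) hαx) (fun l hl => by
      obtain ⟨b, -, hb⟩ := key l hl
      exact ⟨b, hb⟩)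
  refine ⟨v, latticeClass_eq_mk0 F hF J (le_antisymm ?_ ?_)⟩
  · rintro _ ⟨l, rfl⟩
    obtain ⟨b, hb, hb'⟩ := key l l.2
    rw [← hFl] at hb'
    have : b = F l := NumberField.RingOfIntegers.ext (hinj hb')
    exact this ▸ hb
  · intro b hb
    -- For `b ∈ J` the element `b / α` carries `I` into the ring of integers, hence `I B` into `B`;
    -- and `g ∈ I B`.
    have hmem : iota x (b / α) * g ∈ hurwitz := by
      have hle : M ≤ hurwitz.toAddSubgroup.comap (AddMonoidHom.mulLeft (iota x (b / α))) := by
        rw [AddSubgroup.closure_le]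
        rintro _ ⟨a, ha, r, hr, rfl⟩
        change iota x (b / α) * (iota x a * r) ∈ hurwitz
        have hab : a * b ∈ Ideal.span {α} := by
          rw [← hα]
          exact Ideal.mul_mem_mul ha hb
        obtain ⟨s, hs⟩ := Ideal.mem_span_singleton'.1 hab
        have hs' : (s : ImagQuad d) * α = a * b := by
          rw [← map_mul, hs, map_mul]
        rw [← mul_assoc, ← map_mul]
        have : (b / α * a : ImagQuad d) = s := by
          rw [div_mul_eq_mul_div, div_eq_iff hα0', hs', mul_comm]
        rw [this]
        exact mul_mem (iota_mem_self x s).1 hr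
      exact hle hg
    refine ⟨⟨iota x (b / α) * g, hmem, ?_⟩, ?_⟩
    · rw [← mul_assoc, mul_assoc _ g, ← hxg, ← mul_assoc,
        iota_mul_eq_mul_iota (x := x) (y := x) rfl]
    · apply NumberField.RingOfIntegers.ext
      apply hinj
      rw [hFl]
      simp only []
      rw [mul_assoc, mul_inv_cancel_left₀ g0, ← map_mul, div_mul_cancel₀ _ hα0']

end Classes

/-! ### Signed permutation matrices -/

/-- The matrix sending the `j`-th basis vector to `s j` times the `σ j`-th one. -/
def signedPerm (σ : Equiv.Perm (Fin 3)) (s : Fin 3 → ℤˣ) : Matrix (Fin 3) (Fin 3) ℤ :=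
  Matrix.of fun i j => if i = σ j then (s j : ℤ) else 0

theorem signedPerm_det (σ : Equiv.Perm (Fin 3)) (s : Fin 3 → ℤˣ) :
    (signedPerm σ s).det = (σ.sign * ∏ i, s i : ℤˣ) := by
  rw [Matrix.det_fin_three]
  revert σ s
  decide

theorem signedPerm_transpose_mul (σ : Equiv.Perm (Fin 3)) (s : Fin 3 → ℤˣ) :
    (signedPerm σ s).transpose * signedPerm σ s = 1 := by
  ext i j
  rw [Matrix.mul_apply]
  by_cases hij : i = j
  · subst hij
    simp [signedPerm, ← Units.val_mul]
  · simp [signedPerm, hij, (σ.injective.ne hij).symm]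

theorem signedPerm_injective {σ τ : Equiv.Perm (Fin 3)} {s t : Fin 3 → ℤˣ}
    (h : signedPerm σ s = signedPerm τ t) : σ = τ ∧ s = t := by
  have key : ∀ j, σ j = τ j ∧ s j = t j := by
    intro j
    have hj := congrFun (congrFun h (σ j)) j
    simp only [signedPerm, Matrix.of_apply, if_true] at hj
    by_cases hst : σ j = τ j
    · rw [if_pos hst] at hj
      exact ⟨hst, Units.ext hj⟩
    · rw [if_neg hst] at hj
      exact absurd hj (s j).ne_zero
  exact ⟨Equiv.ext fun j => (key j).1, funext fun j => (key j).2⟩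

theorem exists_unit_of_sum_sq_eq_one {f : Fin 3 → ℤ} (h : ∑ i, f i * f i = 1) :
    ∃ i, ∃ u : ℤˣ, ∀ k, f k = if k = i then (u : ℤ) else 0 := by
  have hne : ∃ i, f i ≠ 0 := by
    by_contra! h0
    simp [h0] at h
  obtain ⟨i, hi⟩ := hne
  rw [← Finset.add_sum_erase _ _ (Finset.mem_univ i)] at h
  have h1 : 0 ≤ ∑ k ∈ Finset.univ.erase i, f k * f k :=
    Finset.sum_nonneg fun k _ => mul_self_nonneg _
  have h2 : 0 < f i * f i := mul_self_pos.2 hi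
  have h3 : ∑ k ∈ Finset.univ.erase i, f k * f k = 0 := by omega
  have h4 : f i * f i = 1 := by omega
  rw [Finset.sum_eq_zero_iff_of_nonneg fun k _ => mul_self_nonneg _] at h3
  refine ⟨i, ⟨f i, f i, h4, h4⟩, fun k => ?_⟩
  split_ifs with hk
  · rw [hk]
  · exact mul_self_eq_zero.1 (h3 k (Finset.mem_erase.2 ⟨hk, Finset.mem_univ k⟩))

/-- The columns are integral unit vectors, hence signed basis vectors, and orthogonality makes their
positions distinct. -/
theorem exists_signedPerm (g : SO3Z) : ∃ (σ : Equiv.Perm (Fin 3)) (s : Fin 3 → ℤˣ),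
    g.1 = signedPerm σ s ∧ σ.sign * ∏ i, s i = 1 := by
  have hg := SO3Z.transpose_mul g
  have horth : ∀ j k, ∑ i, g.1 i j * g.1 i k = if j = k then 1 else 0 := by
    intro j k
    have := congrFun (congrFun hg j) k
    rwa [Matrix.mul_apply, Matrix.one_apply] at this
  have hcol : ∀ j, ∃ i, ∃ u : ℤˣ, ∀ k, g.1 k j = if k = i then (u : ℤ) else 0 := fun j =>
    exists_unit_of_sum_sq_eq_one (by rw [horth, if_pos rfl])
  choose σ s hs using hcol
  have hinj : Function.Injective σ := by
    intro j k hjk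
    by_contra hne
    have := horth j k
    simp [hs, hjk, hne] at this
  let σ' : Equiv.Perm (Fin 3) := Equiv.ofBijective σ (Finite.injective_iff_bijective.1 hinj)
  have heq : g.1 = signedPerm σ' s := by
    ext i j
    exact hs j i
  refine ⟨σ', s, heq, ?_⟩
  have hdet : g.1.det = 1 := (Matrix.mem_specialOrthogonalGroup_iff.1 g.2).2
  rw [heq, signedPerm_det] at hdet
  exact Units.ext hdet

/-- The rotation given by a signed permutation matrix of determinant one. -/
def SO3Z.ofSignedPerm (σ : Equiv.Perm (Fin 3)) (s : Fin 3 → ℤˣ) (h : σ.sign * ∏ i, s i = 1) :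
    SO3Z :=
  ⟨signedPerm σ s, Matrix.mem_specialOrthogonalGroup_iff.2
    ⟨(Matrix.mem_orthogonalGroup_iff' (Fin 3) ℤ).2 (signedPerm_transpose_mul σ s), by
      rw [signedPerm_det, h]; rfl⟩⟩

theorem mem_SO3ZPlus_iff {g : SO3Z} {σ : Equiv.Perm (Fin 3)} {s : Fin 3 → ℤˣ}
    (h : g.1 = signedPerm σ s) : g ∈ SO3ZPlus ↔ σ.sign = 1 := by
  constructor
  · rintro ⟨τ, hτ, hg⟩
    have : σ = τ := Equiv.ext fun i => hg i (σ i) (by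
      rw [h]
      simp [signedPerm])
    rwa [this]
  · intro hσ
    refine ⟨σ, hσ, fun i j hij => ?_⟩
    rw [h] at hij
    by_contra hne
    exact hij (if_neg hne)

theorem card_SO3Z : Nat.card SO3Z = 24 := by
  let f : {p : Equiv.Perm (Fin 3) × (Fin 3 → ℤˣ) // p.1.sign * ∏ i, p.2 i = 1} → SO3Z :=
    fun p => SO3Z.ofSignedPerm p.1.1 p.1.2 p.2
  have hf : Function.Bijective f := by
    constructor
    · intro p q hpq
      obtain ⟨h1, h2⟩ := signedPerm_injective (congrArg Subtype.val hpq)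
      exact Subtype.ext (Prod.ext h1 h2)
    · intro g
      obtain ⟨σ, s, hg, h⟩ := exists_signedPerm g
      exact ⟨⟨(σ, s), h⟩, Subtype.ext hg.symm⟩
  rw [← Nat.card_congr (Equiv.ofBijective f hf), Nat.card_eq_fintype_card]
  decide

theorem card_SO3ZPlus : Nat.card SO3ZPlus = 12 := by
  let f : {p : Equiv.Perm (Fin 3) × (Fin 3 → ℤˣ) //
      p.1.sign * ∏ i, p.2 i = 1 ∧ p.1.sign = 1} → SO3ZPlus :=
    fun p => ⟨SO3Z.ofSignedPerm p.1.1 p.1.2 p.2.1, (mem_SO3ZPlus_iff rfl).2 p.2.2⟩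
  have hf : Function.Bijective f := by
    constructor
    · intro p q hpq
      obtain ⟨h1, h2⟩ := signedPerm_injective (congrArg (fun g => g.1.1) hpq)
      exact Subtype.ext (Prod.ext h1 h2)
    · intro g
      obtain ⟨σ, s, hg, h⟩ := exists_signedPerm g.1
      exact ⟨⟨(σ, s), h, (mem_SO3ZPlus_iff hg).1 g.2⟩, Subtype.ext (Subtype.ext hg.symm)⟩
  rw [← Nat.card_congr (Equiv.ofBijective f hf), Nat.card_eq_fintype_card]
  decide

/-! ### Rotations as conjugations by quaternions -/

/-- The matrix `M` is, on the basis vectors, conjugation by the quaternion `t + u i + v j + w k`. -/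
def ConjEq (M : Matrix (Fin 3) (Fin 3) ℤ) (t u v w : ℤ) : Prop :=
  let E : Matrix (Fin 3) (Fin 3) ℤ := 1
  ∀ j : Fin 3,
    -- The real, `i`, `j`, `k` components of `(M e_j) q = q e_j`, the real one with both signs
    -- reversed.
    M 0 j * u + M 1 j * v + M 2 j * w = u * E 0 j + v * E 1 j + w * E 2 j ∧
    M 0 j * t + M 1 j * w - M 2 j * v = t * E 0 j + v * E 2 j - w * E 1 j ∧
    M 1 j * t + M 2 j * u - M 0 j * w = t * E 1 j + w * E 0 j - u * E 2 j ∧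
    M 2 j * t + M 0 j * v - M 1 j * u = t * E 2 j + u * E 1 j - v * E 0 j

instance (M : Matrix (Fin 3) (Fin 3) ℤ) (t u v w : ℤ) : Decidable (ConjEq M t u v w) := by
  unfold ConjEq
  infer_instance

theorem ConjEq.toQuat_mul {M : Matrix (Fin 3) (Fin 3) ℤ} {t u v w : ℤ} (h : ConjEq M t u v w)
    {q : ℍ[ℚ]} (h0 : q.re = t / 2) (h1 : q.imI = u / 2) (h2 : q.imJ = v / 2) (h3 : q.imK = w / 2)
    (a : Fin 3 → ℤ) : toQuat (M.mulVec a) * q = q * toQuat a := by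
  have hM : ∀ i, ((M.mulVec a i : ℤ) : ℚ) = M i 0 * a 0 + M i 1 * a 1 + M i 2 * a 2 := by
    intro i
    simp [Matrix.mulVec, dotProduct, Fin.sum_univ_three]
  obtain ⟨r0, i0, j0, k0⟩ := h 0
  obtain ⟨r1, i1, j1, k1⟩ := h 1
  obtain ⟨r2, i2, j2, k2⟩ := h 2
  simp at r0 r1 r2 i0 i1 i2 j0 j1 j2 k0 k1 k2
  qify at r0 r1 r2 i0 i1 i2 j0 j1 j2 k0 k1 k2
  ext
  · simp only [Quaternion.re_mul, toQuat_re, toQuat_imI, toQuat_imJ, toQuat_imK, hM, h0, h1, h2, h3]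
    linear_combination -(a 0 / 2 : ℚ) * r0 - (a 1 / 2 : ℚ) * r1 - (a 2 / 2 : ℚ) * r2
  · simp only [Quaternion.imI_mul, toQuat_re, toQuat_imI, toQuat_imJ, toQuat_imK, hM, h0, h1, h2,
      h3]
    linear_combination (a 0 / 2 : ℚ) * i0 + (a 1 / 2 : ℚ) * i1 + (a 2 / 2 : ℚ) * i2
  · simp only [Quaternion.imJ_mul, toQuat_re, toQuat_imI, toQuat_imJ, toQuat_imK, hM, h0, h1, h2,
      h3]
    linear_combination (a 0 / 2 : ℚ) * j0 + (a 1 / 2 : ℚ) * j1 + (a 2 / 2 : ℚ) * j2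
  · simp only [Quaternion.imK_mul, toQuat_re, toQuat_imI, toQuat_imJ, toQuat_imK, hM, h0, h1, h2,
      h3]
    linear_combination (a 0 / 2 : ℚ) * k0 + (a 1 / 2 : ℚ) * k1 + (a 2 / 2 : ℚ) * k2

-- Finite check in doubled coordinates: even signed permutations come from units of `B` (square sum
-- 4), odd ones from elements of norm 2 (square sum 8). Since `q` and `-q` give the same rotation,
-- `t ≥ 0` suffices.
set_option maxRecDepth 100000 in
theorem exists_conjEq_of_signedPerm : ∀ (σ : Equiv.Perm (Fin 3)) (s : Fin 3 → ℤˣ),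
    σ.sign * ∏ i, s i = 1 →
    ∃ t ∈ [2, 1, 0], ∃ u ∈ [0, 1, -1, 2, -2], ∃ v ∈ [0, 1, -1, 2, -2], ∃ w ∈ [0, 1, -1, 2, -2],
      (t ^ 2 + u ^ 2 + v ^ 2 + w ^ 2 : ℤ) = (if σ.sign = 1 then 4 else 8) ∧
      ConjEq (signedPerm σ s) t u v w := by
  decide

-- The converse finite check; the congruences say that the halved quaternion is Hurwitz, and a
-- square sum of at most 8 keeps every coordinate within `±2`.
set_option maxRecDepth 100000 in
theorem exists_signedPerm_of_conjEq : ∀ t ∈ [-2, -1, 0, 1, 2], ∀ u ∈ [-2, -1, 0, 1, 2],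
    ∀ v ∈ [-2, -1, 0, 1, 2], ∀ w ∈ [-2, -1, 0, 1, 2], ∀ n ∈ [4, 8],
    (t ^ 2 + u ^ 2 + v ^ 2 + w ^ 2 : ℤ) = n →
    2 ∣ u - t ∧ 2 ∣ v - t ∧ 2 ∣ w - t →
    ∃ (σ : Equiv.Perm (Fin 3)) (s : Fin 3 → ℤˣ), σ.sign * ∏ i, s i = 1 ∧
      (n = 4 → σ.sign = 1) ∧ ConjEq (signedPerm σ s) t u v w := by
  decide

theorem exists_quat_of_rotation (g : SO3Z) : ∃ q ∈ hurwitz,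
    (∀ a, toQuat (g.1.mulVec a) * q = q * toQuat a) ∧
    (g ∈ SO3ZPlus ∧ nrm q = 1 ∨ g ∉ SO3ZPlus ∧ nrm q = 2) := by
  obtain ⟨σ, s, hg, h⟩ := exists_signedPerm g
  obtain ⟨t, -, u, -, v, -, w, -, hn, hc⟩ := exists_conjEq_of_signedPerm σ s h
  let q : ℍ[ℚ] := ⟨t / 2, u / 2, v / 2, w / 2⟩
  have key : ∀ n : ℤ, t ^ 2 + u ^ 2 + v ^ 2 + w ^ 2 = 4 * n → q ∈ hurwitz ∧ nrm q = n := by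
    intro n hn
    refine ⟨mem_hurwitz_of_four_squares (q := q) rfl rfl rfl rfl hn, nrm_of_eq ?_⟩
    have hn' : (t : ℚ) ^ 2 + u ^ 2 + v ^ 2 + w ^ 2 = 4 * n := by exact_mod_cast hn
    rw [Quaternion.normSq_def']
    change (t / 2 : ℚ) ^ 2 + (u / 2) ^ 2 + (v / 2) ^ 2 + (w / 2) ^ 2 = n
    linear_combination (1 / 4 : ℚ) * hn'
  have hconj : ∀ a, toQuat (g.1.mulVec a) * q = q * toQuat a := by
    rw [hg]
    exact hc.toQuat_mul rfl rfl rfl rfl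
  by_cases hσ : σ.sign = 1
  · rw [if_pos hσ] at hn
    obtain ⟨hq, hq1⟩ := key 1 hn
    exact ⟨q, hq, hconj, Or.inl ⟨(mem_SO3ZPlus_iff hg).2 hσ, hq1⟩⟩
  · rw [if_neg hσ] at hn
    obtain ⟨hq, hq2⟩ := key 2 hn
    exact ⟨q, hq, hconj, Or.inr ⟨mt (mem_SO3ZPlus_iff hg).1 hσ, hq2⟩⟩

theorem exists_rotation_of_quat {q : ℍ[ℚ]} (hq : q ∈ hurwitz) (hn : nrm q = 1 ∨ nrm q = 2) :
    ∃ g : SO3Z, (∀ a, toQuat (g.1.mulVec a) * q = q * toQuat a) ∧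
      (nrm q = 1 → g ∈ SO3ZPlus) := by
  obtain ⟨t, u, v, w, h0, h1, h2, h3, hu, hv, hw, hs⟩ := exists_doubled hq
  have range : ∀ r : ℤ, r ^ 2 ≤ 8 → r ∈ [-2, -1, 0, 1, 2] := by
    intro r hr
    have h1 : -3 < r := by nlinarith
    have h2 : r < 3 := by nlinarith
    simp only [List.mem_cons, List.not_mem_nil, or_false]
    omega
  have b0 := sq_nonneg t
  have b1 := sq_nonneg u
  have b2 := sq_nonneg v
  have b3 := sq_nonneg w
  obtain ⟨σ, s, hσs, hσ, hc⟩ := exists_signedPerm_of_conjEq t (range t (by omega)) u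
    (range u (by omega)) v (range v (by omega)) w (range w (by omega)) (4 * nrm q)
    (by rcases hn with h | h <;> simp [h]) hs ⟨hu, hv, hw⟩
  exact ⟨SO3Z.ofSignedPerm σ s hσs, hc.toQuat_mul h0 h1 h2 h3,
    fun h => (mem_SO3ZPlus_iff rfl).2 (hσ (by rw [h]; norm_num))⟩

/-! ### Orbits and ideal classes -/

theorem toQuat_injective : Function.Injective toQuat := by
  intro v w h
  have h0 := congrArg QuaternionAlgebra.imI h
  have h1 := congrArg QuaternionAlgebra.imJ h
  have h2 := congrArg QuaternionAlgebra.imK h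
  simp only [toQuat_imI, toQuat_imJ, toQuat_imK, Int.cast_inj] at h0 h1 h2
  funext i
  fin_cases i
  · exact h0
  · exact h1
  · exact h2

section Orbits

variable {d : ℕ}

theorem orbitStar_eq_iff {x y : sphere d} :
    orbitStar x = orbitStar y ↔ ∃ g ∈ starGroup d, g • y = x := by
  rw [orbitStar, orbitStar, Quotient.eq]
  exact ⟨fun ⟨g, hg⟩ => ⟨g.1, g.2, hg⟩, fun ⟨g, hg, h⟩ => ⟨⟨g, hg⟩, h⟩⟩

theorem orbit_eq_iff {x y : sphere d} : orbit x = orbit y ↔ ∃ g : SO3Z, g • y = x := by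
  rw [orbit, orbit, Quotient.eq]
  rfl

theorem proj_orbitStar (x : sphere d) : proj (orbitStar x) = orbit x := rfl

theorem orbitStar_surjective : Function.Surjective (orbitStar (d := d)) := Quotient.mk_surjective

theorem proj_surjective : Function.Surjective (proj (d := d)) := by
  intro P
  obtain ⟨x, rfl⟩ := Quotient.mk_surjective P
  exact ⟨orbitStar x, rfl⟩

theorem exists_mem_transporter_of_rotation (g : SO3Z) : ∃ q : ℍ[ℚ],
    (∀ x : sphere d, q ∈ transporter (g • x) x) ∧
    (g ∈ SO3ZPlus ∧ nrm q = 1 ∨ g ∉ SO3ZPlus ∧ nrm q = 2) := by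
  obtain ⟨q, hq, h, hn⟩ := exists_quat_of_rotation g
  exact ⟨q, fun x => ⟨hq, h x.1⟩, hn⟩

theorem proj_injective_of_mod_four (h3 : d % 4 = 3) : Function.Injective (proj (d := d)) := by
  intro p q h
  obtain ⟨x, rfl⟩ := orbitStar_surjective p
  obtain ⟨y, rfl⟩ := orbitStar_surjective q
  rw [proj_orbitStar, proj_orbitStar, orbit_eq_iff] at h
  obtain ⟨g, hg⟩ := h
  exact orbitStar_eq_iff.2 ⟨g, by rw [starGroup, if_pos h3]; exact Subgroup.mem_top g, hg⟩

variable [hsq : Fact (Squarefree d)]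

theorem mod_four_ne_zero : d % 4 ≠ 0 := by
  intro h
  have := hsq.out 2 (Nat.dvd_of_mod_eq_zero h)
  simp at this

/-- Rotations act freely on the sphere of radius `√d`. -/
theorem eq_one_of_smul_eq (hd : 3 < d) (hd7 : d % 8 ≠ 7) {g : SO3Z} {x : sphere d}
    (h : g • x = x) : g = 1 := by
  obtain ⟨q, hq, hconj, hn⟩ := exists_quat_of_rotation g
  have hqT : q ∈ transporter x x := ⟨hq, by
    have := hconj x.1
    rwa [show g.1.mulVec x.1 = x.1 from congrArg Subtype.val h] at this⟩
  obtain ⟨a, rfl⟩ := exists_iota_of_mem_self hqT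
  obtain ⟨m, l, hm, hl, hml⟩ := exists_int_nrm_iota x a
  have hle : nrm (iota x a) ≤ 2 := by rcases hn with h | h <;> omega
  have h1 : nrm (iota x a) = 1 ∨ nrm (iota x a) = 2 := by omega
  have hd' : (3 : ℤ) < d := by exact_mod_cast hd
  -- If `l ≠ 0`, then `m² + d l² ≤ 8` with `d ≥ 5` forces `l² = 1` and `|m| ≤ 1`, so `d` is 3, 4, 7
  -- or 8, all excluded. The quaternion is thus a scalar and conjugates trivially.
  have l0 : l = 0 := by
    by_contra hne
    have hl1 : 1 ≤ l ^ 2 := by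
      have := sq_pos_of_ne_zero hne
      omega
    have hm0 : 0 ≤ m ^ 2 := sq_nonneg m
    have d4 := mod_four_ne_zero (d := d)
    have hd5 : (5 : ℤ) ≤ d := by omega
    have hl2 : l ^ 2 < 2 := by nlinarith
    have hl3 : l ^ 2 = 1 := by omega
    rw [hl3] at hml
    have hmb : m ^ 2 ≤ 3 := by omega
    have hm1 : m < 2 := by nlinarith
    have hm2 : -2 < m := by nlinarith
    have : m = -1 ∨ m = 0 ∨ m = 1 := by omega
    rcases this with rfl | rfl | rfl <;> omega
  rw [l0] at hl hml
  have hiota : iota x a = ((m : ℚ) / 2) • 1 := by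
    rw [iota_apply, hm, hl]
    simp
  have hmne : (m : ℚ) / 2 ≠ 0 := by
    have : m ≠ 0 := by
      rintro rfl
      omega
    have : (m : ℚ) ≠ 0 := by exact_mod_cast this
    positivity
  have hfix : ∀ v, g.1.mulVec v = v := by
    intro v
    have hv := hconj v
    rw [hiota, mul_smul_comm, smul_mul_assoc, mul_one, one_mul] at hv
    exact toQuat_injective (smul_right_injective _ hmne hv)
  apply Subtype.ext
  exact Matrix.ext_of_mulVec_single fun i => by
    rw [hfix]
    exact (Matrix.one_mulVec _).symm

theorem latticeClass_self (x : sphere d) : latticeClass x x = 1 :=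
  mul_eq_left.1 (latticeClass_mul x x x)

theorem latticeClass_mul_swap (x y : sphere d) : latticeClass x y * latticeClass y x = 1 := by
  rw [latticeClass_mul, latticeClass_self]

/-- `[gx→gy] = [gx→x] [x→y] [y→gy]`, and the outer factors cancel because `[gx→x]` depends on `g`
alone. This is why the action descends to the full quotient. -/
theorem latticeClass_smul_smul (g : SO3Z) (x y : sphere d) :
    latticeClass (g • x) (g • y) = latticeClass x y := by
  obtain ⟨q, hq, hn⟩ := exists_mem_transporter_of_rotation (d := d) g
  have h : latticeClass (g • x) x = latticeClass (g • y) y := by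
    rcases hn with ⟨-, hn⟩ | ⟨-, hn⟩
    · rw [latticeClass_eq_one_of_nrm_one (hq x) hn, latticeClass_eq_one_of_nrm_one (hq y) hn]
    · exact latticeClass_eq_of_nrm_eq_two (hq x) hn (hq y) hn
  rw [← latticeClass_mul _ x, ← latticeClass_mul x y, h, mul_left_comm, latticeClass_mul_swap,
    mul_one]

/-- A generator of norm 1 or 2 conjugates by a rotation in the relevant group. Conversely, a
rotation outside `SO₃(ℤ)⁺` is allowed only for `d ≡ 3 (mod 4)`, hence `d ≡ 3 (mod 8)`, where its
element of norm 2 generates. -/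
theorem latticeClass_eq_one_iff (hd7 : d % 8 ≠ 7) {x y : sphere d} :
    latticeClass x y = 1 ↔ orbitStar x = orbitStar y := by
  rw [orbitStar_eq_iff]
  constructor
  · intro h
    obtain ⟨q, hq, hn, hn'⟩ := exists_nrm_of_latticeClass_eq_one h
    obtain ⟨g, hg, hgp⟩ := exists_rotation_of_quat hq.1 hn
    refine ⟨g, ?_, ?_⟩
    · rw [starGroup]
      split_ifs with h3
      · exact Subgroup.mem_top g
      · have := mod_four_ne_zero (d := d)
        exact hgp (hn' (by omega))
    · have q0 : q ≠ 0 := by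
        rintro rfl
        rw [nrm_eq_zero.2 rfl] at hn
        omega
      exact Subtype.ext (toQuat_injective (mul_right_cancel₀ q0 ((hg y.1).trans hq.2.symm)))
  · rintro ⟨g, hg, rfl⟩
    obtain ⟨q, hq, ⟨-, hn⟩ | ⟨hgp, hn⟩⟩ := exists_mem_transporter_of_rotation (d := d) g
    · exact latticeClass_eq_one_of_nrm_one (hq y) hn
    · have h3 : d % 4 = 3 := by
        by_contra h3
        rw [starGroup, if_neg h3] at hg
        exact hgp hg
      exact latticeClass_eq_one_of_nrm_two (by omega) (hq y) hn

theorem latticeClass_congr (hd7 : d % 8 ≠ 7) {x x' y y' : sphere d}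
    (hx : orbitStar x = orbitStar x') (hy : orbitStar y = orbitStar y') :
    latticeClass x y = latticeClass x' y' := by
  rw [← latticeClass_mul x x' y, ← latticeClass_mul x' y' y, (latticeClass_eq_one_iff hd7).2 hx,
    (latticeClass_eq_one_iff hd7).2 hy.symm, one_mul, mul_one]

theorem latticeClass_eq_iff (hd7 : d % 8 ≠ 7) {x y z : sphere d} :
    latticeClass x y = latticeClass x z ↔ orbitStar y = orbitStar z := by
  rw [← latticeClass_mul x y z, left_eq_mul, latticeClass_eq_one_iff hd7]

/-- The action of the class group on the starred quotient. -/
@[reducible]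
noncomputable def starAction (hd7 : d % 8 ≠ 7) :
    MulAction (ClassGroup (𝓞 (ImagQuad d))) (HStar d) where
  smul g p := orbitStar (exists_latticeClass_eq p.out g).choose
  one_smul p := by
    change orbitStar (exists_latticeClass_eq p.out 1).choose = p
    rw [← (latticeClass_eq_one_iff hd7).1 (exists_latticeClass_eq p.out 1).choose_spec]
    exact Quotient.out_eq p
  mul_smul g h p := by
    obtain ⟨q, hq⟩ : ∃ q, q = orbitStar (exists_latticeClass_eq p.out h).choose := ⟨_, rfl⟩
    change orbitStar (exists_latticeClass_eq p.out (g * h)).choose =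
      orbitStar (exists_latticeClass_eq (orbitStar (exists_latticeClass_eq p.out h).choose).out
        g).choose
    -- Moving by `h` and then by `g` composes to the class `h * g`; commutativity makes this a left
    -- action.
    rw [← hq, ← latticeClass_eq_iff hd7 (x := p.out),
      (exists_latticeClass_eq p.out (g * h)).choose_spec, ← latticeClass_mul p.out q.out,
      (exists_latticeClass_eq q.out g).choose_spec, mul_comm]
    congr 1
    rw [← (exists_latticeClass_eq p.out h).choose_spec]
    exact ((latticeClass_eq_iff hd7).2 ((Quotient.out_eq q).trans hq)).symm

theorem starAction_smul_eq_iff (hd7 : d % 8 ≠ 7) (x y : sphere d)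
    (g : ClassGroup (𝓞 (ImagQuad d))) :
    (starAction hd7).smul g (orbitStar x) = orbitStar y ↔ g = latticeClass x y := by
  have hx : orbitStar (orbitStar x).out = orbitStar x := Quotient.out_eq _
  change orbitStar (exists_latticeClass_eq (orbitStar x).out g).choose = orbitStar y ↔ _
  rw [← latticeClass_eq_iff hd7 (x := (orbitStar x).out),
    (exists_latticeClass_eq (orbitStar x).out g).choose_spec, latticeClass_congr hd7 hx rfl]

end Orbits

/-! ### The action on the full quotient, stabilisers and the count -/

section Descent

variable {d : ℕ} [hsq : Fact (Squarefree d)]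

theorem proj_starAction_congr (hd7 : d % 8 ≠ 7) (g : ClassGroup (𝓞 (ImagQuad d))) {p q : HStar d}
    (h : proj p = proj q) : proj ((starAction hd7).smul g p) = proj ((starAction hd7).smul g q) := by
  obtain ⟨x, rfl⟩ := orbitStar_surjective p
  obtain ⟨y, rfl⟩ := orbitStar_surjective q
  rw [proj_orbitStar, proj_orbitStar, orbit_eq_iff] at h
  obtain ⟨ρ, rfl⟩ := h
  obtain ⟨z, rfl⟩ := exists_latticeClass_eq y g
  rw [(starAction_smul_eq_iff hd7 y z _).2 rfl,
    (starAction_smul_eq_iff hd7 (ρ • y) (ρ • z) _).2 (latticeClass_smul_smul ρ y z).symm,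
    proj_orbitStar, proj_orbitStar, orbit_eq_iff]
  exact ⟨ρ, rfl⟩

/-- The action of the class group on the full quotient. -/
@[reducible]
noncomputable def tildeAction (hd7 : d % 8 ≠ 7) :
    MulAction (ClassGroup (𝓞 (ImagQuad d))) (HTilde d) where
  smul g P := proj ((starAction hd7).smul g (Function.surjInv proj_surjective P))
  one_smul P := by
    change proj ((starAction hd7).smul 1 (Function.surjInv proj_surjective P)) = P
    rw [show (starAction hd7).smul 1 (Function.surjInv proj_surjective P) =
      Function.surjInv proj_surjective P from (starAction hd7).one_smul _]
    exact Function.surjInv_eq _ P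
  mul_smul g h P := by
    change proj ((starAction hd7).smul (g * h) (Function.surjInv proj_surjective P)) =
      proj ((starAction hd7).smul g (Function.surjInv proj_surjective
        (proj ((starAction hd7).smul h (Function.surjInv proj_surjective P)))))
    rw [show (starAction hd7).smul (g * h) (Function.surjInv proj_surjective P) =
      (starAction hd7).smul g ((starAction hd7).smul h (Function.surjInv proj_surjective P)) from
      (starAction hd7).mul_smul g h _]
    exact proj_starAction_congr hd7 g (Function.surjInv_eq _ _).symm

theorem proj_starAction (hd7 : d % 8 ≠ 7) (g : ClassGroup (𝓞 (ImagQuad d))) (p : HStar d) :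
    proj ((starAction hd7).smul g p) = (tildeAction hd7).smul g (proj p) :=
  proj_starAction_congr hd7 g (Function.surjInv_eq _ _).symm

/-- The class `[x→y]` moves the orbit of `x` to that of `y`; these agree when `y = ρ⁻¹ x`, and
`[x→ρ⁻¹x] = [ρx→x]` by equivariance. -/
theorem tildeAction_smul_orbit_eq_iff (hd7 : d % 8 ≠ 7) (x : sphere d)
    (g : ClassGroup (𝓞 (ImagQuad d))) :
    (tildeAction hd7).smul g (orbit x) = orbit x ↔ ∃ ρ : SO3Z, g = latticeClass (ρ • x) x := by
  obtain ⟨y, rfl⟩ := exists_latticeClass_eq x g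
  rw [← proj_orbitStar x, ← proj_starAction hd7, (starAction_smul_eq_iff hd7 x y _).2 rfl,
    proj_orbitStar, proj_orbitStar, orbit_eq_iff]
  constructor
  · rintro ⟨ρ, rfl⟩
    refine ⟨ρ⁻¹, ?_⟩
    rw [← latticeClass_smul_smul ρ (ρ⁻¹ • x) x, smul_inv_smul]
  · rintro ⟨ρ, hρ⟩
    rw [← latticeClass_smul_smul ρ⁻¹ (ρ • x) x, inv_smul_smul, latticeClass_eq_iff hd7,
      orbitStar_eq_iff] at hρ
    obtain ⟨τ, -, hτ⟩ := hρ
    exact ⟨τ * ρ⁻¹, by rw [mul_smul, hτ]⟩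

theorem exists_latticeClass_of_orbit_eq (h12 : d % 4 = 1 ∨ d % 4 = 2) {x y : sphere d}
    (hne : orbitStar x ≠ orbitStar y) (h : orbit x = orbit y) :
    ∃ P : (Ideal (𝓞 (ImagQuad d)))⁰, IsPrimeAboveTwo P ∧
      latticeClass x y = ClassGroup.mk0 P := by
  obtain ⟨ρ, rfl⟩ := orbit_eq_iff.1 h
  obtain ⟨q, hq, ⟨hρ, -⟩ | ⟨-, hn⟩⟩ := exists_mem_transporter_of_rotation (d := d) ρ
  · refine absurd (orbitStar_eq_iff.2 ⟨ρ, ?_, rfl⟩) hne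
    rwa [starGroup, if_neg (by omega)]
  · obtain ⟨P, hP, hc, -⟩ := exists_prime_of_nrm_eq_two (hq y) hn
    exact ⟨P, hP, hc⟩

theorem exists_not_mem_SO3ZPlus : ∃ ρ : SO3Z, ρ ∉ SO3ZPlus := by
  by_contra! h
  have := card_SO3ZPlus
  rw [(Subgroup.eq_top_iff' _).2 h, Subgroup.card_top, card_SO3Z] at this
  norm_num at this

/-- The stabiliser consists of the classes `[ρx→x]`, trivial for `ρ` in `SO₃(ℤ)⁺` and equal to one
class of a prime above 2 otherwise. That class is nontrivial because rotations act freely, so `ρ x`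
and `x` lie in different `SO₃(ℤ)⁺`-orbits. -/
theorem stabilizer_tildeAction (hd : 3 < d) (hd7 : d % 8 ≠ 7) (h12 : d % 4 = 1 ∨ d % 4 = 2)
    (p : HTilde d) (S : Subgroup (ClassGroup (𝓞 (ImagQuad d))))
    (hS : ∀ g, g ∈ S ↔ (tildeAction hd7).smul g p = p) :
    Nat.card S = 2 ∧ ∃ P : (Ideal (𝓞 (ImagQuad d)))⁰, IsPrimeAboveTwo P ∧
      S = Subgroup.zpowers (ClassGroup.mk0 P) := by
  obtain ⟨x, rfl⟩ := Quotient.mk_surjective p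
  replace hS : ∀ g, g ∈ S ↔ ∃ ρ : SO3Z, g = latticeClass (ρ • x) x := fun g =>
    (hS g).trans (tildeAction_smul_orbit_eq_iff hd7 x g)
  obtain ⟨ρ, hρ⟩ := exists_not_mem_SO3ZPlus
  have hne : orbitStar (ρ • x) ≠ orbitStar x := by
    intro h
    obtain ⟨τ, hτ, h'⟩ := orbitStar_eq_iff.1 h.symm
    rw [starGroup, if_neg (by omega)] at hτ
    rw [← mul_smul] at h'
    have h1 := eq_one_of_smul_eq hd hd7 h'
    rw [mul_eq_one_iff_eq_inv'] at h1
    exact hρ (h1 ▸ inv_mem hτ)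
  obtain ⟨P, hP, hc⟩ := exists_latticeClass_of_orbit_eq h12 hne (orbit_eq_iff.2 ⟨ρ, rfl⟩)
  have hc1 : ClassGroup.mk0 P ≠ 1 := by
    rw [← hc, Ne, latticeClass_eq_one_iff hd7]
    exact hne
  have hPS : ClassGroup.mk0 P ∈ S := (hS _).2 ⟨ρ, hc.symm⟩
  have hmem : ∀ g, g ∈ S ↔ g = 1 ∨ g = ClassGroup.mk0 P := by
    intro g
    constructor
    · rw [hS]
      rintro ⟨τ, rfl⟩
      obtain ⟨q, hq, ⟨-, hn⟩ | ⟨-, hn⟩⟩ := exists_mem_transporter_of_rotation (d := d) τ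
      · exact Or.inl (latticeClass_eq_one_of_nrm_one (hq x) hn)
      · obtain ⟨q', hq', ⟨hρ', -⟩ | ⟨-, hn'⟩⟩ := exists_mem_transporter_of_rotation (d := d) ρ
        · exact absurd hρ' hρ
        · exact Or.inr ((latticeClass_eq_of_nrm_eq_two (hq x) hn (hq' x) hn').trans hc)
    · rintro (rfl | rfl)
      · exact one_mem S
      · exact hPS
  refine ⟨?_, P, hP, le_antisymm (fun g hg => ?_) (Subgroup.zpowers_le.2 hPS)⟩
  · have : (S : Set (ClassGroup (𝓞 (ImagQuad d)))) = {1, ClassGroup.mk0 P} := Set.ext hmem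
    change Nat.card (S : Set (ClassGroup (𝓞 (ImagQuad d)))) = 2
    rw [this, Nat.card_coe_set_eq, Set.ncard_pair hc1.symm]
  · rcases (hmem g).1 hg with rfl | rfl
    · exact one_mem _
    · exact Subgroup.mem_zpowers _

/-- The action on the sphere is free, so the sphere is the group times the orbit set, and the orbit
set is a torsor for the class group. -/
theorem card_sphere (hd : 3 < d) (hd7 : d % 8 ≠ 7) :
    Nat.card (sphere d) = Nat.card (starGroup d) * Nat.card (ClassGroup (𝓞 (ImagQuad d))) := by
  have hfree : ∀ x : sphere d, MulAction.stabilizer (starGroup d) x = ⊥ := by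
    intro x
    rw [Subgroup.eq_bot_iff_forall]
    intro g hg
    exact Subtype.ext (eq_one_of_smul_eq hd hd7 (x := x) hg)
  obtain ⟨x⟩ := sphere_nonempty hsq.out (by omega) hd7
  have hbij : Function.Bijective fun g : ClassGroup (𝓞 (ImagQuad d)) =>
      (starAction hd7).smul g (orbitStar x) := by
    constructor
    · intro g h hgh
      obtain ⟨y, rfl⟩ := exists_latticeClass_eq x g
      have h1 := (starAction_smul_eq_iff hd7 x y _).2 rfl
      exact ((starAction_smul_eq_iff hd7 x y h).1 (hgh.symm.trans h1)).symm
    · intro q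
      obtain ⟨y, rfl⟩ := orbitStar_surjective q
      exact ⟨_, (starAction_smul_eq_iff hd7 x y _).2 rfl⟩
  rw [Nat.card_congr (MulAction.selfEquivOrbitsQuotientProd hfree), Nat.card_prod, mul_comm,
    Nat.card_congr (Equiv.ofBijective _ hbij)]

end Descent

end ThreeSquares

theorem mainTheorem6 (d : ℕ) [Fact (Squarefree d)] (hd : 3 < d) (hd7 : d % 8 ≠ 7) :
    -- the torsor structure on the starred quotient, and the action on the full quotient
    (∃ act : MulAction (ClassGroup (𝓞 (ImagQuad d))) (HStar d),
      (Nonempty (HStar d) ∧ MulAction.IsPretransitive (ClassGroup (𝓞 (ImagQuad d))) (HStar d) ∧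
        ∀ p : HStar d, MulAction.stabilizer (ClassGroup (𝓞 (ImagQuad d))) p = ⊥) ∧
      (∀ (x y : sphere d) (g : ClassGroup (𝓞 (ImagQuad d))),
        g • orbitStar x = orbitStar y ↔ g = latticeClass x y) ∧
      ∃ act' : MulAction (ClassGroup (𝓞 (ImagQuad d))) (HTilde d),
        (∀ (g : ClassGroup (𝓞 (ImagQuad d))) (p : HStar d), proj (g • p) = g • proj p) ∧
        MulAction.IsPretransitive (ClassGroup (𝓞 (ImagQuad d))) (HTilde d) ∧
        (d % 4 = 3 →
          ∀ p : HTilde d, MulAction.stabilizer (ClassGroup (𝓞 (ImagQuad d))) p = ⊥) ∧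
        (d % 4 = 1 ∨ d % 4 = 2 → ∀ p : HTilde d,
          Nat.card (MulAction.stabilizer (ClassGroup (𝓞 (ImagQuad d))) p) = 2 ∧
          ∃ P : (Ideal (𝓞 (ImagQuad d)))⁰, IsPrimeAboveTwo P ∧
            MulAction.stabilizer (ClassGroup (𝓞 (ImagQuad d))) p =
              Subgroup.zpowers (ClassGroup.mk0 P))) ∧
    -- composition, as bimodules; the ring of integers acts on the left factor also through right
    -- multiplication by `O_y`, so that this is the tensor product over `O_y`
    (∀ x y z : sphere d,
      ∃ φ : transporter x y ⊗[𝓞 (ImagQuad d)] transporter y z ≃+ transporter x z,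
        (∀ a ∈ order x, ∀ (l l' : transporter x y) (m : transporter y z),
          (l' : ℍ[ℚ]) = a * l → (φ (l' ⊗ₜ m) : ℍ[ℚ]) = a * φ (l ⊗ₜ m)) ∧
        (∀ b ∈ order z, ∀ (l : transporter x y) (m m' : transporter y z),
          (m' : ℍ[ℚ]) = m * b → (φ (l ⊗ₜ m') : ℍ[ℚ]) = φ (l ⊗ₜ m) * b)) ∧
    -- trivial classes
    (∀ x y : sphere d, latticeClass x y = 1 ↔ orbitStar x = orbitStar y) ∧
    -- every class occurs
    (∀ (x : sphere d) (g : ClassGroup (𝓞 (ImagQuad d))), ∃ y : sphere d, latticeClass x y = g) ∧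
    -- the fibres of the projection
    (d % 4 = 1 ∨ d % 4 = 2 → ∀ x y : sphere d, orbitStar x ≠ orbitStar y → orbit x = orbit y →
      ∃ P : (Ideal (𝓞 (ImagQuad d)))⁰, IsPrimeAboveTwo P ∧
        latticeClass x y = ClassGroup.mk0 P) ∧
    -- the number of representations
    (d % 8 = 3 → Nat.card (sphere d) = 24 * Nat.card (ClassGroup (𝓞 (ImagQuad d)))) ∧
    (d % 4 = 1 ∨ d % 4 = 2 →
      Nat.card (sphere d) = 12 * Nat.card (ClassGroup (𝓞 (ImagQuad d)))) := by
  refine ⟨⟨starAction hd7, ⟨?_, ?_, ?_⟩, starAction_smul_eq_iff hd7, tildeAction hd7,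
    proj_starAction hd7, ?_, ?_, ?_⟩, ?_, fun x y => latticeClass_eq_one_iff hd7,
    exists_latticeClass_eq, fun h12 x y => exists_latticeClass_of_orbit_eq h12, ?_, ?_⟩
  · obtain ⟨x⟩ := sphere_nonempty (Fact.out : Squarefree d) (by omega) hd7
    exact ⟨orbitStar x⟩
  · refine @MulAction.IsPretransitive.mk _ _ (starAction hd7).toSMul fun p q => ?_
    obtain ⟨x, rfl⟩ := orbitStar_surjective p
    obtain ⟨y, rfl⟩ := orbitStar_surjective q
    exact ⟨_, (starAction_smul_eq_iff hd7 x y _).2 rfl⟩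
  · intro p
    obtain ⟨x, rfl⟩ := orbitStar_surjective p
    rw [Subgroup.eq_bot_iff_forall]
    intro g hg
    rw [(starAction_smul_eq_iff hd7 x x g).1 hg, latticeClass_self]
  · refine @MulAction.IsPretransitive.mk _ _ (tildeAction hd7).toSMul fun p q => ?_
    obtain ⟨x, rfl⟩ := Quotient.mk_surjective p
    obtain ⟨y, rfl⟩ := Quotient.mk_surjective q
    exact ⟨latticeClass x y, (proj_starAction hd7 _ (orbitStar x)).symm.trans
      (congrArg proj ((starAction_smul_eq_iff hd7 x y _).2 rfl))⟩
  · intro h3 p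
    obtain ⟨x, rfl⟩ := Quotient.mk_surjective p
    rw [Subgroup.eq_bot_iff_forall]
    intro g hg
    have hg' : (tildeAction hd7).smul g (proj (orbitStar x)) = proj (orbitStar x) := hg
    -- For `d ≡ 3 (mod 4)` the two quotients coincide, so triviality of the stabiliser is inherited
    -- from the torsor.
    have h := proj_injective_of_mod_four h3 ((proj_starAction hd7 g (orbitStar x)).trans hg')
    rw [(starAction_smul_eq_iff hd7 x x g).1 h, latticeClass_self]
  · exact fun h12 p => stabilizer_tildeAction hd hd7 h12 p _ fun g => Iff.rfl
  · intro x y z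
    obtain ⟨φ, h1, h2⟩ := exists_bimodule_equiv x y z
    exact ⟨φ.toAddEquiv, h1, h2⟩
  · intro h3
    rw [card_sphere hd hd7, starGroup, if_pos (by omega), Subgroup.card_top, card_SO3Z]
  · intro h12
    rw [card_sphere hd hd7, starGroup, if_neg (by omega), card_SO3ZPlus]
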